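/- Let $\mathbb K$ be $\mathbb R$ or $\mathbb C$; all spaces and algebras are over $\mathbb K$, and $B(X)$ denotes the bounded operators on a Banach space $X$. A Banach algebra dynamical system $(A,G,\alpha)$ consists of a (not necessarily unital) Banach algebra $A$, a locally compact Hausdorff group $G$ with a fixed left Haar measure, and a strongly continuous representation $\alpha$ of $G$ on $A$ by bounded algebra automorphisms. A covariant representation of $(A,G,\alpha)$ on a Banach space $X$ is a pair $(\pi,U)$ of an algebra representation $\pi:A\to B(X)$ and a representation $U$ of $G$ on $X$ by invertible bounded operators, with $\pi(\alpha_s(a))=U_s\pi(a)U_s^{-1}$ for all $a\in A$, $s\in G$. It is continuous if $\pi$ is norm-bounded and $U$ is strongly continuous, and non-degenerate if the span of $\pi(A)X$ is dense in $X$. For continuous $(\pi,U)$ and $f\in C_c(G,A)$ put $\pi\rtimes U(f)x:=\int_G\pi(f(s))U_sx\,ds$ $(x\in X)$. A class $\mathcal R$ of continuous covariant representations is uniformly bounded if there are $C\ge0$ and $\nu:G\to[0,\infty)$, bounded on compact sets, such that $\|\pi\|\le C$ and $\|U_r\|\le\nu(r)$ for all $(\pi,U)\in\mathcal R$ and $r\in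 G$. For a non-empty such class let $\sigma^{\mathcal R}(f):=\sup_{(\pi,U)\in\mathcal R}\|\pi\rtimes U(f)\|$. This is an algebra seminorm on $C_c(G,A)$ with the twisted convolution $(f*g)(s)=\int_Gf(r)\alpha_r(g(r^{-1}s))\,dr$, and the crossed product $(A\rtimes_\alpha G)^{\mathcal R}$ is the completion of $C_c(G,A)/\ker\sigma^{\mathcal R}$. A continuous covariant representation $(\pi,U)$ is $\mathcal R$-continuous if $\pi\rtimes U$ is bounded with respect to $\sigma^{\mathcal R}$; then $(\pi\rtimes U)^{\mathcal R}:(A\rtimes_\alpha G)^{\mathcal R}\to B(X)$ denotes the induced bounded representation. Two pairs $(\pi_1,U_1)$, $(\pi_2,U_2)$ on $X$ commute if each of $\pi_1,U_1$ commutes with both $\pi_2$ and $U_2$. A bounded representation $T$ of a Banach algebra $B$ on $X$ is non-degenerate if the span of $T(B)X$ is dense in $X$. For pairwise commuting bounded representations $T_i$ of Banach algebras $B_i$ on $X$ $(1\le i\le n)$, $\widehat{\bigodot}_{i=1}^nT_i:\widehat{\bigotimes}_{i=1}^nB_i\to B(X)$ is the bounded representation of the projective tensor product determined by $b_1\otimes\cdots\otimes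 b_n\mapsto T_1(b_1)\cdots T_n(b_n)$. **Theorem.** For $i\in\{1,\dots,n\}$, let $(A_i,G_i,\alpha_i)$ be a Banach algebra dynamical system, where $A_i$ has a bounded approximate left identity, and let $\mathcal R_i$ be a non-empty uniformly bounded class of non-degenerate continuous covariant representations of $(A_i,G_i,\alpha_i)$. Let $X$ be a Banach space. Consider the $n$-tuples $((\pi_1,U_1),\dots,(\pi_n,U_n))$ where each $(\pi_i,U_i)$ is a non-degenerate $\mathcal R_i$-continuous covariant representation of $(A_i,G_i,\alpha_i)$ on $X$, and $(\pi_i,U_i)$ and $(\pi_j,U_j)$ commute whenever $i\ne j$. Then the map $$((\pi_1,U_1),\dots,(\pi_n,U_n))\mapsto\widehat{\bigodot}_{i=1}^n(\pi_i\rtimes U_i)^{\mathcal R_i}$$ is a bijection from the set of all such $n$-tuples onto the set of all non-degenerate bounded representations of $\widehat{\bigotimes}_{i=1}^n(A_i\rtimes_{\alpha_i}G_i)^{\mathcal R_i}$ on $X$. -/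

import Mathlib

set_option linter.unusedSectionVars false

open MeasureTheory Topology
open scoped CompactlySupported TensorProduct Pointwise

universe w

/-! ### Completions of (possibly non-unital) seminormed algebras -/

/-- The Banach algebra obtained from a seminormed algebra `E` by dividing out the kernel of the
seminorm and completing (the Hausdorff completion), with the continuously extended product. -/
def BanachCompletion (E : Type*) [NonUnitalSeminormedRing E] : Type _ :=
  UniformSpace.Completion E

namespace BanachCompletion

section Ring

variable {E : Type*} [NonUnitalSeminormedRing E]

noncomputable instance instNormedAddCommGroup : NormedAddCommGroup (BanachCompletion E) :=
  inferInstanceAs (NormedAddCommGroup (UniformSpace.Completion E))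

instance instCompleteSpace : CompleteSpace (BanachCompletion E) :=
  inferInstanceAs (CompleteSpace (UniformSpace.Completion E))

/-- The canonical map from `E` to its completion. -/
noncomputable def of (x : E) : BanachCompletion E := UniformSpace.Completion.toCompl x

theorem of_add (x y : E) : of (x + y) = of x + of y :=
  map_add (UniformSpace.Completion.toCompl : E →+ UniformSpace.Completion E) x y

theorem norm_of (x : E) : ‖of x‖ = ‖x‖ := UniformSpace.Completion.norm_coe x

theorem continuous_of : Continuous (of : E → BanachCompletion E) :=
  UniformSpace.Completion.continuous_coe E

theorem isDenseInducing_of : IsDenseInducing (of : E → BanachCompletion E) :=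
  UniformSpace.Completion.isDenseInducing_coe

theorem denseRange_of : DenseRange (of : E → BanachCompletion E) :=
  isDenseInducing_of.dense

noncomputable instance instMul : Mul (BanachCompletion E) :=
  ⟨Function.curry <|
    ((isDenseInducing_of (E := E)).prodMap (isDenseInducing_of (E := E))).extend
      (of ∘ Function.uncurry (· * ·))⟩

theorem of_mul (a b : E) : of (a * b) = of a * of b :=
  (((isDenseInducing_of (E := E)).prodMap (isDenseInducing_of (E := E))).extend_eq
      ((continuous_of (E := E)).comp (continuous_mul (M := E))) (a, b)).symm

theorem continuous_mul' : Continuous fun p : BanachCompletion E × BanachCompletion E =>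
    p.1 * p.2 := by
  let m : E →+ E →+ UniformSpace.Completion E :=
    (AddMonoidHom.mul : E →+ E →+ E).compr₂ UniformSpace.Completion.toCompl
  have : Continuous fun p : E × E => m p.1 p.2 :=
    (UniformSpace.Completion.continuous_coe E).comp continuous_mul
  have di : IsDenseInducing (UniformSpace.Completion.toCompl : E → UniformSpace.Completion E) :=
    UniformSpace.Completion.isDenseInducing_coe
  exact (di.extend_Z_bilin di this :)

theorem mul_closed {Z : Type*} [TopologicalSpace Z] {f g : Z → BanachCompletion E}
    (hf : Continuous f) (hg : Continuous g) : Continuous fun z => f z * g z :=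
  continuous_mul'.comp (hf.prodMk hg)

noncomputable instance instNonUnitalRing : NonUnitalRing (BanachCompletion E) where
  zero_mul a := by
    refine denseRange_of.induction_on (p := fun a => 0 * a = 0) a
      (isClosed_eq (mul_closed continuous_const continuous_id) continuous_const) fun x => ?_
    have h0 : (0 : BanachCompletion E) = of 0 := UniformSpace.Completion.coe_zero.symm
    rw [h0, ← of_mul, zero_mul]
  mul_zero a := by
    refine denseRange_of.induction_on (p := fun a => a * 0 = 0) a
      (isClosed_eq (mul_closed continuous_id continuous_const) continuous_const) fun x => ?_
    have h0 : (0 : BanachCompletion E) = of 0 := UniformSpace.Completion.coe_zero.symm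
    rw [h0, ← of_mul, mul_zero]
  mul_assoc a b c := by
    refine denseRange_of.induction_on₃ (p := fun a b c => a * b * c = a * (b * c))
      (isClosed_eq ?_ ?_) (fun x y z => ?_) a b c
    · exact mul_closed (mul_closed (by fun_prop) (by fun_prop)) (by fun_prop)
    · exact mul_closed (by fun_prop) (mul_closed (by fun_prop) (by fun_prop))
    · simp only [← of_mul, mul_assoc]
  left_distrib a b c := by
    refine denseRange_of.induction_on₃ (p := fun a b c => a * (b + c) = a * b + a * c)
      (isClosed_eq ?_ ?_) (fun x y z => ?_) a b c
    · exact mul_closed (by fun_prop) (by fun_prop)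
    · exact (mul_closed (by fun_prop) (by fun_prop)).add (mul_closed (by fun_prop) (by fun_prop))
    · simp only [← of_mul, ← of_add, mul_add]
  right_distrib a b c := by
    refine denseRange_of.induction_on₃ (p := fun a b c => (a + b) * c = a * c + b * c)
      (isClosed_eq ?_ ?_) (fun x y z => ?_) a b c
    · exact mul_closed (by fun_prop) (by fun_prop)
    · exact (mul_closed (by fun_prop) (by fun_prop)).add (mul_closed (by fun_prop) (by fun_prop))
    · simp only [← of_mul, ← of_add, add_mul]

noncomputable instance instNonUnitalNormedRing : NonUnitalNormedRing (BanachCompletion E) where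
  __ := instNormedAddCommGroup
  __ := instNonUnitalRing
  norm_mul_le a b := by
    refine denseRange_of.induction_on₂ (p := fun a b => ‖a * b‖ ≤ ‖a‖ * ‖b‖)
      (isClosed_le ?_ ?_) (fun x y => ?_) a b
    · exact (mul_closed (by fun_prop) (by fun_prop)).norm
    · fun_prop
    · rw [← of_mul, norm_of, norm_of, norm_of]
      exact norm_mul_le x y

end Ring

section Algebra

variable {𝕜 : Type*} [RCLike 𝕜] {E : Type*} [NonUnitalSeminormedRing E] [NormedSpace 𝕜 E]

noncomputable instance instNormedSpace : NormedSpace 𝕜 (BanachCompletion E) :=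
  inferInstanceAs (NormedSpace 𝕜 (UniformSpace.Completion E))

variable (𝕜 E) in
/-- The canonical map from `E` to its completion, as a continuous linear map. -/
noncomputable def ofL : E →L[𝕜] BanachCompletion E :=
  (UniformSpace.Completion.toComplL : E →L[𝕜] UniformSpace.Completion E)

theorem ofL_apply (x : E) : ofL 𝕜 E x = of x := rfl

theorem of_smul (c : 𝕜) (x : E) : of (c • x) = c • of x := UniformSpace.Completion.coe_smul c x

instance instIsScalarTower [IsScalarTower 𝕜 E E] :
    IsScalarTower 𝕜 (BanachCompletion E) (BanachCompletion E) where
  smul_assoc c a b := by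
    have h₁ : Continuous fun p : BanachCompletion E × BanachCompletion E => (c • p.1) * p.2 :=
      mul_closed (continuous_fst.const_smul c) continuous_snd
    have h₂ : Continuous fun p : BanachCompletion E × BanachCompletion E => c • (p.1 * p.2) :=
      (mul_closed continuous_fst continuous_snd).const_smul c
    refine denseRange_of.induction_on₂ (p := fun a b => (c • a) * b = c • (a * b))
      (isClosed_eq h₁ h₂) (fun x y => ?_) a b
    rw [← of_smul, ← of_mul, ← of_mul, ← of_smul, smul_mul_assoc]

instance instSMulCommClass [SMulCommClass 𝕜 E E] :
    SMulCommClass 𝕜 (BanachCompletion E) (BanachCompletion E) where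
  smul_comm c a b := by
    have h₁ : Continuous fun p : BanachCompletion E × BanachCompletion E => p.1 * (c • p.2) :=
      mul_closed continuous_fst (continuous_snd.const_smul c)
    have h₂ : Continuous fun p : BanachCompletion E × BanachCompletion E => c • (p.1 * p.2) :=
      (mul_closed continuous_fst continuous_snd).const_smul c
    refine denseRange_of.induction_on₂ (p := fun a b => c • (a * b) = a * (c • b))
      (isClosed_eq h₂ h₁) (fun x y => ?_) a b
    rw [← of_smul, ← of_mul, ← of_mul, ← of_smul, mul_smul_comm]

/-- The extension by continuity of a bounded linear map to the completion. -/
noncomputable def extend {F : Type*} [NormedAddCommGroup F] [NormedSpace 𝕜 F] [CompleteSpace F]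
    (T : E →L[𝕜] F) : BanachCompletion E →L[𝕜] F :=
  T.extend (ofL 𝕜 E)

theorem extend_of {F : Type*} [NormedAddCommGroup F] [NormedSpace 𝕜 F] [CompleteSpace F]
    (T : E →L[𝕜] F) (x : E) : extend T (of x) = T x :=
  T.extend_eq (e := ofL 𝕜 E) denseRange_of
    (UniformSpace.Completion.isUniformInducing_coe E) x

end Algebra

end BanachCompletion

/-! ### Projective tensor products of finitely many Banach algebras -/

section ProjectiveTensor

variable (𝕜 : Type*) [RCLike 𝕜] {n : ℕ} (B : Fin n → Type*) [∀ i, NonUnitalNormedRing (B i)]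
  [∀ i, NormedSpace 𝕜 (B i)] [∀ i, IsScalarTower 𝕜 (B i) (B i)]
  [∀ i, SMulCommClass 𝕜 (B i) (B i)]

/-- The algebraic tensor product `⨂ i, B i`, regarded as an algebra with
`(⨂ bᵢ) (⨂ cᵢ) = ⨂ bᵢ cᵢ` and equipped with the projective tensor norm. -/
def AlgTensorProduct : Type _ := ⨂[𝕜] i, B i

noncomputable instance AlgTensorProduct.instSeminormedAddCommGroup :
    SeminormedAddCommGroup (AlgTensorProduct 𝕜 B) :=
  inferInstanceAs (SeminormedAddCommGroup (⨂[𝕜] i, B i))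

noncomputable instance AlgTensorProduct.instMul : Mul (AlgTensorProduct 𝕜 B) :=
  inferInstanceAs (Mul (⨂[𝕜] i, B i))

noncomputable instance AlgTensorProduct.instNonUnitalSemiring :
    NonUnitalSemiring (AlgTensorProduct 𝕜 B) :=
  inferInstanceAs (NonUnitalSemiring (⨂[𝕜] i, B i))

variable {𝕜 B} in
theorem AlgTensorProduct.bound (f : (⨂[𝕜] i, B i) →ₗ[𝕜] ⨂[𝕜] i, B i) {C : ℝ} (hC : 0 ≤ C)
    (h : ∀ m : Π i, B i, ‖f (PiTensorProduct.tprod 𝕜 m)‖ ≤ C * ∏ i, ‖m i‖) (x : ⨂[𝕜] i, B i) :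
    ‖f x‖ ≤ C * ‖x‖ := by
  let g := MultilinearMap.mkContinuous (f.compMultilinearMap (PiTensorProduct.tprod 𝕜)) C h
  have h₁ := PiTensorProduct.norm_eval_le_projectiveSeminorm g x
  have h₂ : PiTensorProduct.lift g.toMultilinearMap = f := by
    ext m
    simp only [PiTensorProduct.lift.tprod, LinearMap.compMultilinearMap_apply]
    rfl
  rw [h₂] at h₁
  exact h₁.trans (mul_le_mul_of_nonneg_right (MultilinearMap.mkContinuous_norm_le _ hC _)
    (norm_nonneg _))

theorem AlgTensorProduct.norm_mul_le' (x y : ⨂[𝕜] i, B i) : ‖x * y‖ ≤ ‖x‖ * ‖y‖ := by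
  refine AlgTensorProduct.bound (PiTensorProduct.mul x) (norm_nonneg x) (fun m' => ?_) y
  rw [mul_comm]
  refine AlgTensorProduct.bound (PiTensorProduct.mul.flip (PiTensorProduct.tprod 𝕜 m'))
    (Finset.prod_nonneg fun i _ => norm_nonneg _) (fun m => ?_) x
  rw [LinearMap.flip_apply, PiTensorProduct.mul_tprod_tprod, ← Finset.prod_mul_distrib]
  refine (PiTensorProduct.projectiveSeminorm_tprod_le _).trans ?_
  refine Finset.prod_le_prod (fun i _ => norm_nonneg _) fun i _ => ?_
  rw [mul_comm]
  exact norm_mul_le _ _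

noncomputable instance AlgTensorProduct.instNonUnitalSeminormedRing :
    NonUnitalSeminormedRing (AlgTensorProduct 𝕜 B) where
  __ := AlgTensorProduct.instSeminormedAddCommGroup 𝕜 B
  __ := AlgTensorProduct.instNonUnitalSemiring 𝕜 B
  norm_mul_le x y := AlgTensorProduct.norm_mul_le' 𝕜 B x y

noncomputable instance AlgTensorProduct.instNormedSpace : NormedSpace 𝕜 (AlgTensorProduct 𝕜 B) :=
  inferInstanceAs (NormedSpace 𝕜 (⨂[𝕜] i, B i))

instance AlgTensorProduct.instIsScalarTower :
    IsScalarTower 𝕜 (AlgTensorProduct 𝕜 B) (AlgTensorProduct 𝕜 B) where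
  smul_assoc c x y := (PiTensorProduct.mul (R := 𝕜) (A := B)).map_smul₂ c x y

instance AlgTensorProduct.instSMulCommClass :
    SMulCommClass 𝕜 (AlgTensorProduct 𝕜 B) (AlgTensorProduct 𝕜 B) where
  smul_comm c x y := ((PiTensorProduct.mul (R := 𝕜) (A := B) x).map_smul c y).symm

/-- The projective tensor product of the Banach algebras `B i`, as a Banach algebra. -/
abbrev ProjTensorProduct : Type _ := BanachCompletion (AlgTensorProduct 𝕜 B)

variable {𝕜 B} in
/-- For bounded linear maps `T i : B i → B(X)`, the bounded linear map `T₁ ⊙ ⋯ ⊙ Tₙ` on the projective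
tensor product determined by `⨂ bᵢ ↦ T₁(b₁) T₂(b₂) ⋯ Tₙ(bₙ)`. It is used for commuting
representations `T i`. -/
noncomputable def sunProduct {X : Type*} [NormedAddCommGroup X] [NormedSpace 𝕜 X]
    [CompleteSpace X] (T : ∀ i, B i →L[𝕜] (X →L[𝕜] X)) :
    ProjTensorProduct 𝕜 B →L[𝕜] (X →L[𝕜] X) :=
  BanachCompletion.extend (PiTensorProduct.liftIsometry 𝕜 B (X →L[𝕜] X)
    ((ContinuousMultilinearMap.mkPiAlgebraFin 𝕜 n (X →L[𝕜] X)).compContinuousLinearMap T) :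
      (⨂[𝕜] i, B i) →L[𝕜] (X →L[𝕜] X))

variable {𝕜 B} in
/-- The elementary tensor `⨂ bᵢ` in the projective tensor product. -/
noncomputable def elemTensor (b : ∀ i, B i) : ProjTensorProduct 𝕜 B :=
  BanachCompletion.of (E := AlgTensorProduct 𝕜 B) (PiTensorProduct.tprod 𝕜 b)

variable {𝕜 B} in
theorem sunProduct_elemTensor {X : Type*} [NormedAddCommGroup X] [NormedSpace 𝕜 X]
    [CompleteSpace X] (T : ∀ i, B i →L[𝕜] (X →L[𝕜] X)) (b : ∀ i, B i) :
    sunProduct T (elemTensor b) = (List.ofFn fun i => T i (b i)).prod := by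
  refine (BanachCompletion.extend_of _ _).trans ?_
  exact (PiTensorProduct.liftIsometry_apply_apply _ _).trans (by simp)

end ProjectiveTensor

/-! ### Integrals of compactly supported continuous vector-valued functions -/

section Integral

variable {G : Type*} [TopologicalSpace G] [MeasurableSpace G]

/-- The integral of a vector-valued function; over `𝕜 = ℂ` the real structure used by the Bochner
integral is the underlying one. -/
noncomputable def vecIntegral (𝕜 : Type*) [RCLike 𝕜] {E : Type*} [NormedAddCommGroup E]
    [NormedSpace 𝕜 E] (μ : Measure G) (f : G → E) : E :=
  letI : NormedSpace ℝ E := NormedSpace.restrictScalars ℝ 𝕜 E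
  ∫ s, f s ∂μ

variable {𝕜 : Type*} [RCLike 𝕜] {E F : Type*} [NormedAddCommGroup E] [NormedSpace 𝕜 E]
  [NormedAddCommGroup F] [NormedSpace 𝕜 F] [BorelSpace G] {μ : Measure G}
  [IsFiniteMeasureOnCompacts μ]

theorem vecIntegral_clm [CompleteSpace E] [CompleteSpace F] (L : E →L[𝕜] F) {f : G → E}
    (hf : Continuous f) (hc : HasCompactSupport f) :
    vecIntegral 𝕜 μ (fun s => L (f s)) = L (vecIntegral 𝕜 μ f) := by
  let _ : NormedSpace ℝ E := NormedSpace.restrictScalars ℝ 𝕜 E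
  let _ : NormedSpace ℝ F := NormedSpace.restrictScalars ℝ 𝕜 F
  exact L.integral_comp_comm (hf.integrable_of_hasCompactSupport hc)

theorem vecIntegral_add {f g : G → E}
    (hf : Continuous f) (hfc : HasCompactSupport f) (hg : Continuous g)
    (hgc : HasCompactSupport g) :
    vecIntegral 𝕜 μ (fun s => f s + g s) = vecIntegral 𝕜 μ f + vecIntegral 𝕜 μ g := by
  let _ : NormedSpace ℝ E := NormedSpace.restrictScalars ℝ 𝕜 E
  exact integral_add (hf.integrable_of_hasCompactSupport hfc)
    (hg.integrable_of_hasCompactSupport hgc)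

theorem norm_vecIntegral_le (f : G → E) : ‖vecIntegral 𝕜 μ f‖ ≤ ∫ s, ‖f s‖ ∂μ := by
  let _ : NormedSpace ℝ E := NormedSpace.restrictScalars ℝ 𝕜 E
  exact norm_integral_le_integral_norm f

theorem vecIntegral_swap {f : G → G → E} (hf : Continuous f.uncurry)
    (hc : HasCompactSupport f.uncurry) :
    vecIntegral 𝕜 μ (fun s => vecIntegral 𝕜 μ (fun t => f s t)) =
      vecIntegral 𝕜 μ (fun t => vecIntegral 𝕜 μ (fun s => f s t)) := by
  let _ : NormedSpace ℝ E := NormedSpace.restrictScalars ℝ 𝕜 E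
  exact integral_integral_swap_of_hasCompactSupport hf hc

theorem continuous_vecIntegral {Z : Type*} [TopologicalSpace Z] {f : Z → G → E} {k : Set G}
    (hk : IsCompact k) (hf : Continuous f.uncurry) (h0 : ∀ z, ∀ s, s ∉ k → f z s = 0) :
    Continuous fun z => vecIntegral 𝕜 μ (f z) := by
  let _ : NormedSpace ℝ E := NormedSpace.restrictScalars ℝ 𝕜 E
  rw [← continuousOn_univ]
  exact continuousOn_integral_of_compact_support hk hf.continuousOn fun z s _ hs => h0 z s hs

theorem vecIntegral_shift [Group G] [IsTopologicalGroup G] [μ.IsMulLeftInvariant] (f : G → E)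
    (r : G) : vecIntegral 𝕜 μ (fun s => f (r⁻¹ * s)) = vecIntegral 𝕜 μ f := by
  let _ : NormedSpace ℝ E := NormedSpace.restrictScalars ℝ 𝕜 E
  exact integral_mul_left_eq_self f r⁻¹

/-- A strongly continuous family of operators on a Banach space is bounded on compact sets. -/
theorem bounded_on_compact {Z : Type*} [TopologicalSpace Z] [CompleteSpace E]
    {U : Z → E →L[𝕜] F} (hU : ∀ x, Continuous fun z => U z x) {K : Set Z} (hK : IsCompact K) :
    ∃ M, 0 ≤ M ∧ ∀ z ∈ K, ‖U z‖ ≤ M := by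
  obtain ⟨M, hM⟩ := banach_steinhaus (g := fun z : K => U z) fun x => by
    obtain ⟨C, hC⟩ := hK.exists_bound_of_continuousOn (hU x).continuousOn
    exact ⟨C, fun z => hC z z.2⟩
  exact ⟨max M 0, le_max_right _ _, fun z hz => (hM ⟨z, hz⟩).trans (le_max_left _ _)⟩

theorem continuous_strong {Z Y : Type*} [TopologicalSpace Z] [LocallyCompactSpace Z]
    [TopologicalSpace Y] [CompleteSpace E]
    {U : Z → E →L[𝕜] F} (hU : ∀ x, Continuous fun z => U z x) {u : Y → Z} {v : Y → E}
    (hu : Continuous u) (hv : Continuous v) : Continuous fun y => U (u y) (v y) := by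
  suffices h : Continuous fun p : Z × E => U p.1 p.2 from h.comp (hu.prodMk hv)
  rw [continuous_iff_continuousAt]
  rintro ⟨z₀, x₀⟩
  obtain ⟨K, hK, hz₀⟩ := exists_compact_mem_nhds z₀
  obtain ⟨M, hM0, hM⟩ := bounded_on_compact hU hK
  have h₁ : Filter.Tendsto (fun p : Z × E => U p.1 (p.2 - x₀)) (𝓝 (z₀, x₀)) (𝓝 0) := by
    refine squeeze_zero_norm' (a := fun p => M * ‖p.2 - x₀‖) ?_ ?_
    · filter_upwards [continuous_fst.continuousAt.preimage_mem_nhds (x := (z₀, x₀)) hz₀] with p hp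
      exact (U p.1).le_of_opNorm_le (hM _ hp) _
    · have : Continuous fun p : Z × E => M * ‖p.2 - x₀‖ := by fun_prop
      simpa using this.tendsto (z₀, x₀)
  have h₂ : Filter.Tendsto (fun p : Z × E => U p.1 x₀) (𝓝 (z₀, x₀)) (𝓝 (U z₀ x₀)) :=
    ((hU x₀).comp continuous_fst).tendsto (z₀, x₀)
  have := h₁.add h₂
  simpa [ContinuousAt] using this

end Integral

/-! ### Banach algebra dynamical systems and covariant representations -/

section Systems

/-- `A` has a bounded approximate left identity. -/
def HasBoundedApproxLeftId (A : Type*) [NonUnitalNormedRing A] : Prop :=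
  ∃ l : Filter A, l.NeBot ∧ (∃ M : ℝ, ∀ᶠ u in l, ‖u‖ ≤ M) ∧
    ∀ a : A, Filter.Tendsto (fun u => u * a) l (𝓝 a)

/-- A Banach algebra dynamical system `(A, G, α)`: a strongly continuous representation of `G` on
`A` by bounded algebra automorphisms. -/
structure BanachDynamicalSystem (𝕜 A G : Type*) [RCLike 𝕜] [NonUnitalNormedRing A]
    [NormedSpace 𝕜 A] [Group G] [TopologicalSpace G] where
  act : G →* (A →L[𝕜] A)
  act_mul : ∀ s a b, act s (a * b) = act s a * act s b
  continuous_act : ∀ a, Continuous fun s => act s a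

variable {𝕜 A G : Type*} [RCLike 𝕜] [NonUnitalNormedRing A] [NormedSpace 𝕜 A] [Group G]
  [TopologicalSpace G]

/-- A covariant representation `(π, U)` of `(A, G, α)` on `X`. As `U` is a homomorphism of monoids
defined on a group, it takes values in the invertible operators and `U s⁻¹ = (U s)⁻¹`. -/
structure CovariantRep (α : BanachDynamicalSystem 𝕜 A G) (X : Type*) [NormedAddCommGroup X]
    [NormedSpace 𝕜 X] where
  π : A →ₙₐ[𝕜] (X →L[𝕜] X)
  U : G →* (X →L[𝕜] X)
  covariant : ∀ s a, π (α.act s a) = U s * π a * U s⁻¹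

/-- A continuous covariant representation: `π` is norm-bounded and `U` is strongly continuous. -/
structure ContCovariantRep (α : BanachDynamicalSystem 𝕜 A G) (X : Type*) [NormedAddCommGroup X]
    [NormedSpace 𝕜 X] extends CovariantRep α X where
  bounded : ∃ C : ℝ, ∀ a, ‖π a‖ ≤ C * ‖a‖
  continuous : ∀ x, Continuous fun s => U s x

/-- `(π, U)` is non-degenerate: the span of `π(A)X` is dense in `X`. -/
def CovariantRep.IsNondegenerate {α : BanachDynamicalSystem 𝕜 A G} {X : Type*}
    [NormedAddCommGroup X] [NormedSpace 𝕜 X] (ρ : CovariantRep α X) : Prop :=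
  Dense (Submodule.span 𝕜 {y : X | ∃ a x, ρ.π a x = y} : Set X)

/-- The pairs `(π₁, U₁)` and `(π₂, U₂)` commute: each of `π₁`, `U₁` commutes with both `π₂` and
`U₂`. -/
def CovariantRep.CommutesWith {A' G' : Type*} [NonUnitalNormedRing A'] [NormedSpace 𝕜 A'] [Group G']
    [TopologicalSpace G'] {α : BanachDynamicalSystem 𝕜 A G} {α' : BanachDynamicalSystem 𝕜 A' G'}
    {X : Type*} [NormedAddCommGroup X] [NormedSpace 𝕜 X] (ρ : CovariantRep α X)
    (ρ' : CovariantRep α' X) : Prop :=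
  (∀ a a', Commute (ρ.π a) (ρ'.π a')) ∧ (∀ a s', Commute (ρ.π a) (ρ'.U s')) ∧
    (∀ s a', Commute (ρ.U s) (ρ'.π a')) ∧ (∀ s s', Commute (ρ.U s) (ρ'.U s'))

/-- A continuous covariant representation of `(A, G, α)` together with the Banach space on which it
acts. -/
structure BundledCovariantRep (α : BanachDynamicalSystem 𝕜 A G) where
  X : Type w
  [instNormedAddCommGroup : NormedAddCommGroup X]
  [instNormedSpace : NormedSpace 𝕜 X]
  [instCompleteSpace : CompleteSpace X]
  rep : ContCovariantRep α X

attribute [instance] BundledCovariantRep.instNormedAddCommGroup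
  BundledCovariantRep.instNormedSpace BundledCovariantRep.instCompleteSpace

/-- A non-empty uniformly bounded class of continuous covariant representations of `(A, G, α)`
(on arbitrary Banach spaces in a universe). -/
structure UniformlyBoundedClass (α : BanachDynamicalSystem 𝕜 A G) where
  carrier : Set (BundledCovariantRep.{w} α)
  nonempty : carrier.Nonempty
  uniformly_bounded : ∃ (C : ℝ) (ν : G → ℝ), 0 ≤ C ∧ (∀ r, 0 ≤ ν r) ∧
    (∀ K, IsCompact K → BddAbove (ν '' K)) ∧
    ∀ ρ ∈ carrier, (∀ a, ‖ρ.rep.π a‖ ≤ C * ‖a‖) ∧ ∀ r, ‖ρ.rep.U r‖ ≤ ν r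

end Systems

/-! ### Twisted convolution and integrated forms -/

section Crossed

variable {𝕜 A G : Type*} [RCLike 𝕜] [NonUnitalNormedRing A] [NormedSpace 𝕜 A]
  [IsScalarTower 𝕜 A A] [SMulCommClass 𝕜 A A] [CompleteSpace A] [Group G]
  [TopologicalSpace G] [IsTopologicalGroup G] [LocallyCompactSpace G] [T2Space G]
  [MeasurableSpace G] [BorelSpace G] {α : BanachDynamicalSystem 𝕜 A G}

namespace BanachDynamicalSystem

theorem act_act (α : BanachDynamicalSystem 𝕜 A G) (s t : G) (a : A) :
    α.act s (α.act t a) = α.act (s * t) a := by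
  rw [map_mul]; rfl

/-- If `f` and `g` vanish outside their compact supports then `(s, r) ↦ H (f r) (g (r⁻¹ s))` has
compact support. -/
theorem compactSupport_prod {E : Type*} [Zero E] {f g : G → A} (hf : HasCompactSupport f)
    (hg : HasCompactSupport g) {F : G → G → E} (h₁ : ∀ s r, f r = 0 → F s r = 0)
    (h₂ : ∀ s r, g (r⁻¹ * s) = 0 → F s r = 0) : HasCompactSupport F.uncurry := by
  refine HasCompactSupport.intro ((hf.isCompact.mul hg.isCompact).prod hf.isCompact) ?_
  rintro ⟨s, r⟩ hsr
  by_cases hr : r ∈ tsupport f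
  · refine h₂ s r (image_eq_zero_of_notMem_tsupport fun h => hsr ⟨?_, hr⟩)
    exact ⟨r, hr, r⁻¹ * s, h, by simp⟩
  · exact h₁ s r (image_eq_zero_of_notMem_tsupport hr)

theorem continuous_convIntegrand (α : BanachDynamicalSystem 𝕜 A G) (f g : C_c(G, A)) :
    Continuous (Function.uncurry fun s r : G => f r * α.act r (g (r⁻¹ * s))) := by
  have h : Continuous fun p : G × G => α.act p.2 (g (p.2⁻¹ * p.1)) :=
    continuous_strong α.continuous_act continuous_snd
      (g.continuous.comp (continuous_snd.inv.mul continuous_fst))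
  exact (f.continuous.comp continuous_snd).mul h

/-- The twisted convolution `(f * g)(s) = ∫ f(r) α_r(g(r⁻¹ s)) dr` on `C_c(G, A)`. -/
noncomputable def twistedConv (α : BanachDynamicalSystem 𝕜 A G) (μ : Measure G)
    [IsFiniteMeasureOnCompacts μ] (f g : C_c(G, A)) : C_c(G, A) where
  toFun s := vecIntegral 𝕜 μ fun r => f r * α.act r (g (r⁻¹ * s))
  continuous_toFun := continuous_vecIntegral f.hasCompactSupport.isCompact
    (α.continuous_convIntegrand f g) fun s r hr => by
      rw [image_eq_zero_of_notMem_tsupport hr, zero_mul]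
  hasCompactSupport' := by
    refine HasCompactSupport.intro
      (f.hasCompactSupport.isCompact.mul g.hasCompactSupport.isCompact) fun s hs => ?_
    have : (fun r => f r * α.act r (g (r⁻¹ * s))) = fun _ => 0 := by
      funext r
      by_cases hr : r ∈ tsupport f
      · have : r⁻¹ * s ∉ tsupport g := fun h => hs ⟨r, hr, r⁻¹ * s, h, by simp⟩
        rw [image_eq_zero_of_notMem_tsupport this, map_zero, mul_zero]
      · rw [image_eq_zero_of_notMem_tsupport hr, zero_mul]
    simp [this, vecIntegral]

variable (α : BanachDynamicalSystem 𝕜 A G) (μ : Measure G) [IsFiniteMeasureOnCompacts μ]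

theorem twistedConv_apply (f g : C_c(G, A)) (s : G) :
    α.twistedConv μ f g s = vecIntegral 𝕜 μ fun r => f r * α.act r (g (r⁻¹ * s)) := rfl

theorem continuous_convSlice (f g : C_c(G, A)) (s : G) :
    Continuous fun r : G => f r * α.act r (g (r⁻¹ * s)) :=
  (α.continuous_convIntegrand f g).comp (continuous_const.prodMk continuous_id)

theorem compactSupport_convSlice (f g : C_c(G, A)) (s : G) :
    HasCompactSupport fun r : G => f r * α.act r (g (r⁻¹ * s)) :=
  f.hasCompactSupport.mul_right

theorem twistedConv_add (f g h : C_c(G, A)) :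
    α.twistedConv μ f (g + h) = α.twistedConv μ f g + α.twistedConv μ f h := by
  ext s
  rw [CompactlySupportedContinuousMap.add_apply]
  simp only [twistedConv_apply]
  rw [← vecIntegral_add (α.continuous_convSlice f g s) (α.compactSupport_convSlice f g s)
    (α.continuous_convSlice f h s) (α.compactSupport_convSlice f h s)]
  simp [mul_add]

theorem add_twistedConv (f g h : C_c(G, A)) :
    α.twistedConv μ (f + g) h = α.twistedConv μ f h + α.twistedConv μ g h := by
  ext s
  rw [CompactlySupportedContinuousMap.add_apply]
  simp only [twistedConv_apply]
  rw [← vecIntegral_add (α.continuous_convSlice f h s) (α.compactSupport_convSlice f h s)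
    (α.continuous_convSlice g h s) (α.compactSupport_convSlice g h s)]
  simp [add_mul]

theorem smul_twistedConv (c : 𝕜) (f g : C_c(G, A)) :
    α.twistedConv μ (c • f) g = c • α.twistedConv μ f g := by
  ext s
  rw [CompactlySupportedContinuousMap.smul_apply]
  simp only [twistedConv_apply]
  have := vecIntegral_clm (μ := μ) (c • ContinuousLinearMap.id 𝕜 A) (α.continuous_convSlice f g s)
    (α.compactSupport_convSlice f g s)
  simpa [smul_mul_assoc] using this

theorem twistedConv_smul (c : 𝕜) (f g : C_c(G, A)) :
    α.twistedConv μ f (c • g) = c • α.twistedConv μ f g := by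
  ext s
  rw [CompactlySupportedContinuousMap.smul_apply]
  simp only [twistedConv_apply]
  have := vecIntegral_clm (μ := μ) (c • ContinuousLinearMap.id 𝕜 A) (α.continuous_convSlice f g s)
    (α.compactSupport_convSlice f g s)
  simpa [mul_smul_comm] using this

theorem twistedConv_assoc [μ.IsMulLeftInvariant] (f g h : C_c(G, A)) :
    α.twistedConv μ (α.twistedConv μ f g) h = α.twistedConv μ f (α.twistedConv μ g h) := by
  ext s
  have e₁ : ∀ t, α.twistedConv μ f g t * α.act t (h (t⁻¹ * s)) =
      vecIntegral 𝕜 μ fun r => f r * α.act r (g (r⁻¹ * t)) * α.act t (h (t⁻¹ * s)) := fun t =>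
    (vecIntegral_clm ((ContinuousLinearMap.mul 𝕜 A).flip (α.act t (h (t⁻¹ * s))))
      (α.continuous_convSlice f g t) (α.compactSupport_convSlice f g t)).symm
  have e₂ : ∀ r, f r * α.act r (α.twistedConv μ g h (r⁻¹ * s)) =
      vecIntegral 𝕜 μ fun t => f r * α.act r (g t * α.act t (h (t⁻¹ * (r⁻¹ * s)))) := fun r =>
    (vecIntegral_clm ((ContinuousLinearMap.mul 𝕜 A (f r)).comp (α.act r))
      (α.continuous_convSlice g h (r⁻¹ * s)) (α.compactSupport_convSlice g h (r⁻¹ * s))).symm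
  have e₃ : ∀ r, (vecIntegral 𝕜 μ fun t => f r * α.act r (g t * α.act t (h (t⁻¹ * (r⁻¹ * s))))) =
      vecIntegral 𝕜 μ fun t => f r * α.act r (g (r⁻¹ * t)) * α.act t (h (t⁻¹ * s)) := by
    intro r
    rw [← vecIntegral_shift _ r]
    congr 1
    funext t
    rw [α.act_mul, act_act, mul_assoc]
    simp [mul_assoc]
  rw [twistedConv_apply α μ _ h, twistedConv_apply α μ f]
  simp only [e₁, e₂, e₃]
  refine vecIntegral_swap
    (f := fun t r => f r * α.act r (g (r⁻¹ * t)) * α.act t (h (t⁻¹ * s))) ?_ ?_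
  · refine (α.continuous_convIntegrand f g).mul ?_
    exact continuous_strong α.continuous_act continuous_fst
      (h.continuous.comp (continuous_fst.inv.mul continuous_const))
  · refine compactSupport_prod f.hasCompactSupport g.hasCompactSupport ?_ ?_
    · intro t r h0; rw [h0, zero_mul, zero_mul]
    · intro t r h0; rw [h0, map_zero, mul_zero, zero_mul]

end BanachDynamicalSystem

namespace ContCovariantRep

variable {X : Type*} [NormedAddCommGroup X] [NormedSpace 𝕜 X] [CompleteSpace X]
  (ρ : ContCovariantRep α X)

theorem exists_bound : ∃ C : ℝ, 0 ≤ C ∧ ∀ a, ‖ρ.π a‖ ≤ C * ‖a‖ := by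
  obtain ⟨C, hC⟩ := ρ.bounded
  exact ⟨max C 0, le_max_right _ _, fun a => (hC a).trans
    (mul_le_mul_of_nonneg_right (le_max_left _ _) (norm_nonneg _))⟩

/-- `π` as a bounded linear map. -/
noncomputable def πL : A →L[𝕜] (X →L[𝕜] X) :=
  (ρ.π : A →ₗ[𝕜] (X →L[𝕜] X)).mkContinuousOfExistsBound ρ.bounded

theorem πL_apply (a : A) : ρ.πL a = ρ.π a := rfl

theorem continuous_integrand (f : C_c(G, A)) (x : X) :
    Continuous fun s => ρ.π (f s) (ρ.U s x) :=
  (ρ.πL.continuous.comp f.continuous).clm_apply (ρ.continuous x)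

theorem compactSupport_integrand (f : C_c(G, A)) (x : X) :
    HasCompactSupport fun s => ρ.π (f s) (ρ.U s x) := by
  refine HasCompactSupport.intro f.hasCompactSupport.isCompact fun s hs => ?_
  rw [image_eq_zero_of_notMem_tsupport hs, map_zero]
  rfl

variable (μ : Measure G) [IsFiniteMeasureOnCompacts μ]

theorem norm_integral_le (f : C_c(G, A)) {C M : ℝ} (hC : 0 ≤ C) (hπ : ∀ a, ‖ρ.π a‖ ≤ C * ‖a‖)
    (hU : ∀ s ∈ tsupport f, ‖ρ.U s‖ ≤ M) (x : X) :
    ‖vecIntegral 𝕜 μ fun s => ρ.π (f s) (ρ.U s x)‖ ≤ (C * M * ∫ s, ‖f s‖ ∂μ) * ‖x‖ := by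
  refine (norm_vecIntegral_le _).trans ?_
  have h₁ : ∀ s, ‖ρ.π (f s) (ρ.U s x)‖ ≤ C * M * ‖x‖ * ‖f s‖ := by
    intro s
    by_cases hs : s ∈ tsupport f
    · calc ‖ρ.π (f s) (ρ.U s x)‖ ≤ (C * ‖f s‖) * ‖ρ.U s x‖ := (ρ.π (f s)).le_of_opNorm_le (hπ _) _
        _ ≤ (C * ‖f s‖) * (M * ‖x‖) := by
          gcongr
          exact (ρ.U s).le_of_opNorm_le (hU s hs) _
        _ = _ := by ring
    · simp [image_eq_zero_of_notMem_tsupport hs]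
  calc ∫ s, ‖ρ.π (f s) (ρ.U s x)‖ ∂μ ≤ ∫ s, C * M * ‖x‖ * ‖f s‖ ∂μ := by
        refine integral_mono ?_ ?_ h₁
        · exact ((ρ.continuous_integrand f x).integrable_of_hasCompactSupport
            (ρ.compactSupport_integrand f x)).norm
        · exact ((f.continuous.integrable_of_hasCompactSupport f.hasCompactSupport).norm).const_mul _
    _ = _ := by rw [integral_const_mul]; ring

/-- The operator `π ⋊ U(f)`, given by `x ↦ ∫ π(f(s)) U_s x ds`. -/
noncomputable def integratedOp (f : C_c(G, A)) : X →L[𝕜] X :=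
  LinearMap.mkContinuousOfExistsBound
    { toFun := fun x => vecIntegral 𝕜 μ fun s => ρ.π (f s) (ρ.U s x)
      map_add' := fun x y => by
        rw [← vecIntegral_add (ρ.continuous_integrand f x) (ρ.compactSupport_integrand f x)
          (ρ.continuous_integrand f y) (ρ.compactSupport_integrand f y)]
        simp
      map_smul' := fun c x => by
        have := vecIntegral_clm (μ := μ) (c • ContinuousLinearMap.id 𝕜 X)
          (ρ.continuous_integrand f x) (ρ.compactSupport_integrand f x)
        simpa using this }
    (by
      obtain ⟨C, hC, hπ⟩ := ρ.exists_bound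
      obtain ⟨M, -, hM⟩ := bounded_on_compact ρ.continuous f.hasCompactSupport.isCompact
      exact ⟨_, ρ.norm_integral_le μ f hC hπ hM⟩)

theorem integratedOp_apply (f : C_c(G, A)) (x : X) :
    ρ.integratedOp μ f x = vecIntegral 𝕜 μ fun s => ρ.π (f s) (ρ.U s x) := rfl

/-- The integrated form `π ⋊ U : C_c(G, A) → B(X)`. -/
noncomputable def integratedForm : C_c(G, A) →ₗ[𝕜] (X →L[𝕜] X) where
  toFun := ρ.integratedOp μ
  map_add' f g := by
    ext x
    rw [add_apply]
    simp only [integratedOp_apply]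
    rw [← vecIntegral_add (ρ.continuous_integrand f x) (ρ.compactSupport_integrand f x)
      (ρ.continuous_integrand g x) (ρ.compactSupport_integrand g x)]
    simp
  map_smul' c f := by
    ext x
    have := vecIntegral_clm (μ := μ) (c • ContinuousLinearMap.id 𝕜 X)
      (ρ.continuous_integrand f x) (ρ.compactSupport_integrand f x)
    simpa [integratedOp_apply] using this

theorem integratedForm_apply (f : C_c(G, A)) (x : X) :
    ρ.integratedForm μ f x = vecIntegral 𝕜 μ fun s => ρ.π (f s) (ρ.U s x) := rfl

theorem norm_integratedForm_le (f : C_c(G, A)) {C M : ℝ} (hC : 0 ≤ C) (hM : 0 ≤ M)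
    (hπ : ∀ a, ‖ρ.π a‖ ≤ C * ‖a‖) (hU : ∀ s ∈ tsupport f, ‖ρ.U s‖ ≤ M) :
    ‖ρ.integratedForm μ f‖ ≤ C * M * ∫ s, ‖f s‖ ∂μ :=
  ContinuousLinearMap.opNorm_le_bound _
    (mul_nonneg (mul_nonneg hC hM) (integral_nonneg fun _ => norm_nonneg _))
    (ρ.norm_integral_le μ f hC hπ hU)

theorem integratedForm_mul [μ.IsMulLeftInvariant] (f g : C_c(G, A)) :
    ρ.integratedForm μ (α.twistedConv μ f g) = ρ.integratedForm μ f * ρ.integratedForm μ g := by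
  ext x
  have e₁ : ∀ s, ρ.π (α.twistedConv μ f g s) (ρ.U s x) =
      vecIntegral 𝕜 μ fun r => ρ.π (f r * α.act r (g (r⁻¹ * s))) (ρ.U s x) := fun s =>
    (vecIntegral_clm ((ContinuousLinearMap.apply 𝕜 X (ρ.U s x)).comp ρ.πL)
      (α.continuous_convSlice f g s) (α.compactSupport_convSlice f g s)).symm
  have e₂ : ∀ s r, ρ.π (f r * α.act r (g (r⁻¹ * s))) (ρ.U s x) =
      ρ.π (f r) (ρ.U r (ρ.π (g (r⁻¹ * s)) (ρ.U (r⁻¹ * s) x))) := by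
    intro s r
    rw [map_mul ρ.π, ρ.covariant, map_mul ρ.U]
    rfl
  have e₃ : ∀ r, (vecIntegral 𝕜 μ fun s =>
        ρ.π (f r) (ρ.U r (ρ.π (g (r⁻¹ * s)) (ρ.U (r⁻¹ * s) x)))) =
      ρ.π (f r) (ρ.U r (ρ.integratedForm μ g x)) := by
    intro r
    rw [vecIntegral_shift (fun s => ρ.π (f r) (ρ.U r (ρ.π (g s) (ρ.U s x)))) r]
    exact vecIntegral_clm ((ρ.π (f r)).comp (ρ.U r)) (ρ.continuous_integrand g x)
      (ρ.compactSupport_integrand g x)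
  change _ = ρ.integratedForm μ f (ρ.integratedForm μ g x)
  rw [integratedForm_apply, integratedForm_apply ρ μ f]
  simp only [e₁, ← e₃]
  rw [vecIntegral_swap (f := fun s r => ρ.π (f r * α.act r (g (r⁻¹ * s))) (ρ.U s x))]
  · simp only [e₂]
  · exact (ρ.πL.continuous.comp (α.continuous_convIntegrand f g)).clm_apply
      ((ρ.continuous x).comp continuous_fst)
  · refine BanachDynamicalSystem.compactSupport_prod f.hasCompactSupport g.hasCompactSupport ?_ ?_
    · intro t r h0; simp [h0]
    · intro t r h0; simp [h0]

end ContCovariantRep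

/-! ### The crossed product -/

section CrossedProduct

variable (μ : Measure G) [IsFiniteMeasureOnCompacts μ]

theorem UniformlyBoundedClass.bddAbove (R : UniformlyBoundedClass α) (f : C_c(G, A)) :
    BddAbove (Set.range fun ρ : R.carrier => ‖ρ.1.rep.integratedForm μ f‖) := by
  obtain ⟨C, ν, hC, hν, hK, h⟩ := R.uniformly_bounded
  obtain ⟨M, hM⟩ := hK _ f.hasCompactSupport.isCompact
  refine ⟨C * max M 0 * ∫ s, ‖f s‖ ∂μ, ?_⟩
  rintro _ ⟨ρ, rfl⟩
  refine ρ.1.rep.norm_integratedForm_le μ f hC (le_max_right _ _) (h _ ρ.2).1 fun s hs => ?_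
  exact ((h _ ρ.2).2 s).trans ((hM ⟨s, hs, rfl⟩).trans (le_max_left _ _))

/-- The seminorm `σ^R(f) = sup_{(π, U) ∈ R} ‖π ⋊ U(f)‖` on `C_c(G, A)`. -/
noncomputable def crossedSeminorm (R : UniformlyBoundedClass α) : Seminorm 𝕜 C_c(G, A) :=
  Seminorm.ofSMulLE (fun f => ⨆ ρ : R.carrier, ‖ρ.1.rep.integratedForm μ f‖)
    (by simp)
    (fun f g => by
      have : Nonempty R.carrier := R.nonempty.to_subtype
      refine ciSup_le fun ρ => ?_
      rw [map_add]
      exact (norm_add_le _ _).trans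
        (add_le_add (le_ciSup (R.bddAbove μ f) ρ) (le_ciSup (R.bddAbove μ g) ρ)))
    (fun c f => by
      have : Nonempty R.carrier := R.nonempty.to_subtype
      refine ciSup_le fun ρ => ?_
      rw [map_smul, norm_smul]
      exact mul_le_mul_of_nonneg_left (le_ciSup (R.bddAbove μ f) ρ) (norm_nonneg _))

theorem crossedSeminorm_apply (R : UniformlyBoundedClass α) (f : C_c(G, A)) :
    crossedSeminorm μ R f = ⨆ ρ : R.carrier, ‖ρ.1.rep.integratedForm μ f‖ := rfl

theorem crossedSeminorm_mul [μ.IsMulLeftInvariant] (R : UniformlyBoundedClass α)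
    (f g : C_c(G, A)) :
    crossedSeminorm μ R (α.twistedConv μ f g) ≤ crossedSeminorm μ R f * crossedSeminorm μ R g := by
  have : Nonempty R.carrier := R.nonempty.to_subtype
  refine ciSup_le fun ρ => ?_
  rw [ContCovariantRep.integratedForm_mul]
  exact (norm_mul_le _ _).trans (mul_le_mul (le_ciSup (R.bddAbove μ f) ρ)
    (le_ciSup (R.bddAbove μ g) ρ) (norm_nonneg _) (apply_nonneg _ _))

/-- The algebra `C_c(G, A)` with the twisted convolution and the seminorm `σ^R`. -/
def TwistedConvAlgebra (_μ : Measure G) (_R : UniformlyBoundedClass α) : Type _ := C_c(G, A)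

variable (R : UniformlyBoundedClass α)

noncomputable instance TwistedConvAlgebra.instAddCommGroup :
    AddCommGroup (TwistedConvAlgebra μ R) :=
  inferInstanceAs (AddCommGroup C_c(G, A))

noncomputable instance TwistedConvAlgebra.instModule : Module 𝕜 (TwistedConvAlgebra μ R) :=
  inferInstanceAs (Module 𝕜 C_c(G, A))

/-- `σ^R` on the algebra `TwistedConvAlgebra μ R`. -/
noncomputable def TwistedConvAlgebra.seminorm : Seminorm 𝕜 (TwistedConvAlgebra μ R) :=
  crossedSeminorm μ R

noncomputable instance TwistedConvAlgebra.instSeminormedAddCommGroup :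
    SeminormedAddCommGroup (TwistedConvAlgebra μ R) :=
  AddGroupSeminorm.toSeminormedAddCommGroup (TwistedConvAlgebra.seminorm μ R).toAddGroupSeminorm

noncomputable instance TwistedConvAlgebra.instNonUnitalSeminormedRing [μ.IsMulLeftInvariant] :
    NonUnitalSeminormedRing (TwistedConvAlgebra μ R) where
  __ := TwistedConvAlgebra.instSeminormedAddCommGroup μ R
  mul f g := α.twistedConv μ f g
  left_distrib f g h := α.twistedConv_add μ f g h
  right_distrib f g h := α.add_twistedConv μ f g h
  zero_mul f := by
    have := α.smul_twistedConv μ 0 0 f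
    rw [zero_smul, zero_smul] at this
    exact this
  mul_zero f := by
    have := α.twistedConv_smul μ 0 f 0
    rw [zero_smul, zero_smul] at this
    exact this
  mul_assoc f g h := α.twistedConv_assoc μ f g h
  norm_mul_le f g := crossedSeminorm_mul μ R f g

variable [μ.IsMulLeftInvariant]

noncomputable instance TwistedConvAlgebra.instNormedSpace :
    NormedSpace 𝕜 (TwistedConvAlgebra μ R) where
  __ := TwistedConvAlgebra.instModule μ R
  norm_smul_le c f := (map_smul_eq_mul (TwistedConvAlgebra.seminorm μ R) c f).le

instance TwistedConvAlgebra.instIsScalarTower :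
    IsScalarTower 𝕜 (TwistedConvAlgebra μ R) (TwistedConvAlgebra μ R) where
  smul_assoc c f g := α.smul_twistedConv μ c f g

instance TwistedConvAlgebra.instSMulCommClass :
    SMulCommClass 𝕜 (TwistedConvAlgebra μ R) (TwistedConvAlgebra μ R) where
  smul_comm c f g := (α.twistedConv_smul μ c f g).symm

/-- The crossed product `(A ⋊_α G)^R`. -/
abbrev CrossedProduct : Type _ := BanachCompletion (TwistedConvAlgebra μ R)

variable {X : Type*} [NormedAddCommGroup X] [NormedSpace 𝕜 X] [CompleteSpace X]

/-- `(π, U)` is `R`-continuous: it is continuous and `π ⋊ U` is bounded with respect to `σ^R`. -/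
def ContCovariantRep.IsRContinuous (ρ : ContCovariantRep α X) : Prop :=
  ∃ M : ℝ, ∀ f : C_c(G, A), ‖ρ.integratedForm μ f‖ ≤ M * crossedSeminorm μ R f

variable {R} in
/-- The integrated form of an `R`-continuous covariant representation, as a bounded linear map for
the seminorm `σ^R`. -/
noncomputable def ContCovariantRep.integratedFormL (ρ : ContCovariantRep α X)
    (h : ρ.IsRContinuous μ R) : TwistedConvAlgebra μ R →L[𝕜] (X →L[𝕜] X) :=
  let T : TwistedConvAlgebra μ R →ₗ[𝕜] (X →L[𝕜] X) := ρ.integratedForm μ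
  T.mkContinuousOfExistsBound h

variable {R} in
/-- The map `(π ⋊ U)^R : (A ⋊_α G)^R → B(X)` induced by the integrated form of an `R`-continuous
covariant representation. -/
noncomputable def ContCovariantRep.induced (ρ : ContCovariantRep α X)
    (h : ρ.IsRContinuous μ R) : CrossedProduct μ R →L[𝕜] (X →L[𝕜] X) :=
  BanachCompletion.extend (ρ.integratedFormL μ h)

/-- The quotient homomorphism `q^R : C_c(G, A) → (A ⋊_α G)^R`. -/
noncomputable def quotientMap (f : C_c(G, A)) : CrossedProduct μ R :=
  BanachCompletion.of (E := TwistedConvAlgebra μ R) f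

variable {R} in
theorem ContCovariantRep.induced_quotientMap (ρ : ContCovariantRep α X)
    (h : ρ.IsRContinuous μ R) (f : C_c(G, A)) :
    ρ.induced μ h (quotientMap μ R f) = ρ.integratedForm μ f :=
  BanachCompletion.extend_of (ρ.integratedFormL μ h) _

end CrossedProduct

end Crossed

/-! ### Bounded representations -/

section BoundedRep

variable {𝕜 B X : Type*} [RCLike 𝕜] [NonUnitalNormedRing B] [NormedSpace 𝕜 B]
  [NormedAddCommGroup X] [NormedSpace 𝕜 X]

/-- The bounded linear map `T : B → B(X)` is a non-degenerate representation of the Banach algebra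
`B` on `X`: it is multiplicative and the span of `T(B)X` is dense in `X`. -/
structure IsNondegenerateBoundedRep (T : B →L[𝕜] (X →L[𝕜] X)) : Prop where
  map_mul : ∀ b c, T (b * c) = T b * T c
  dense : Dense (Submodule.span 𝕜 {y : X | ∃ b x, T b x = y} : Set X)

end BoundedRep

/-! The proof rests on one extension principle. Let `T` be a non-degenerate bounded representation
on `X` of a Banach algebra `B` with a bounded approximate left identity `(u)`. A left multiplier `L`
of `B` satisfies `T (L u) T(b) x = T (L (u b)) x → T (L b) x`, so the operators `T (L u)` converge
strongly on the dense span of `T(B)X` to a bounded operator `S` with `S T(b) = T (L b)`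
(`exists_extension`). By density this relation determines `S` (`ext`), so algebraic identities
between multipliers pass to their extensions.

For a single system, `A` and `G` act on the crossed product by left multipliers, `f ↦ a f` and `f ↦
α_r(f(r⁻¹ ·))`. These form a covariant pair whose integrated form is left multiplication
(`canonicalRep_integratedForm`). Extending them along a non-degenerate `T` gives `(π, U)` on `X`
with `π ⋊ U (f) = T (q f)`, where `q` is the quotient map (`exists_eq_induced`). Conversely an
induced `T` satisfies `π(a) T(b) = T (a b)` and `U_r T(b) = T (r b)`, so it determines the pair
(`eq_of_induced_eq`).

For several algebras, `B i` acts on the projective tensor product by left multiplication in the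
`i`-th factor. These left multipliers commute for different `i`, and their product is multiplication
by an elementary tensor (`factorMul_prod`). Hence their extensions `S i` along `T` commute and
multiply to `T` (`exists_eq_sunProduct`); uniqueness follows as before from `mul_sunProduct`.

The principle needs bounded approximate left identities: in the crossed product the classes of `z ⊗
u`, with `z` a bump of integral one shrinking to `1 ∈ G`; in the tensor product the elementary
tensors `u₁ ⊗ ⋯ ⊗ uₙ`. Commutation of covariant pairs passes to the induced representations by
integration, and back by uniqueness of extensions. -/

/-! ### Non-degenerate representations and left multipliers -/

section Multiplier

variable {𝕜 B C X : Type*} [RCLike 𝕜] [NonUnitalNormedRing B] [NormedSpace 𝕜 B]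
  [NonUnitalNormedRing C] [NormedSpace 𝕜 C] [NormedAddCommGroup X] [NormedSpace 𝕜 X]

/-- A bounded operator `L` on `B` is a left multiplier if `L (b c) = L(b) c`. -/
def IsLeftMultiplier (L : B →L[𝕜] B) : Prop := ∀ b c, L (b * c) = L b * c

/-- The points at which a bounded family of operators converges strongly to the identity form a
closed subspace. -/
theorem tendsto_of_dense_span {ι : Type*} {l : Filter ι} {S : ι → X →L[𝕜] X} {M : ℝ}
    (hM : ∀ᶠ i in l, ‖S i‖ ≤ M) {s : Set X} (hs : Dense (Submodule.span 𝕜 s : Set X))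
    (h : ∀ x ∈ s, Filter.Tendsto (fun i => S i x) l (𝓝 x)) (x : X) :
    Filter.Tendsto (fun i => S i x) l (𝓝 x) := by
  have hspan : ∀ x ∈ Submodule.span 𝕜 s, Filter.Tendsto (fun i => S i x) l (𝓝 x) := by
    intro x hx
    induction hx using Submodule.span_induction with
    | mem x hx => exact h x hx
    | zero => simpa using tendsto_const_nhds
    | add x y _ _ hx hy => simpa using hx.add hy
    | smul c x _ hx => simpa using hx.const_smul c
  rw [Metric.tendsto_nhds]
  intro ε hε
  -- With `δ = ε / (max M 0 + 2)`, the three errors below are at most `max M 0 * δ`, `δ` and `δ`,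
  -- which add up to `ε`.
  have hM' : 0 < max M 0 + 2 := by positivity
  obtain ⟨y, hy, hxy⟩ := hs.exists_dist_lt x (div_pos hε hM')
  have hδ := div_pos hε hM'
  filter_upwards [hM, Metric.tendsto_nhds.1 (hspan y hy) _ hδ] with i hi hiy
  rw [dist_eq_norm] at hxy hiy ⊢
  have e : S i x - x = S i (x - y) + (S i y - y) - (x - y) := by rw [map_sub]; abel
  have h₁ : ‖S i (x - y)‖ ≤ max M 0 * (ε / (max M 0 + 2)) :=
    ((S i).le_of_opNorm_le (hi.trans (le_max_left _ _)) _).trans (by gcongr)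
  calc ‖S i x - x‖ ≤ ‖S i (x - y)‖ + ‖S i y - y‖ + ‖x - y‖ := by
        rw [e]; exact (norm_sub_le _ _).trans (by gcongr; exact norm_add_le _ _)
    _ < max M 0 * (ε / (max M 0 + 2)) + ε / (max M 0 + 2) + ε / (max M 0 + 2) := by
        linarith
    _ = ε := by field_simp; ring

namespace IsNondegenerateBoundedRep

variable {T : B →L[𝕜] (X →L[𝕜] X)} (hT : IsNondegenerateBoundedRep T)

include hT

theorem ext {S S' : X →L[𝕜] X} (h : ∀ b, S * T b = S' * T b) : S = S' := by
  refine ContinuousLinearMap.ext_on hT.dense ?_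
  rintro _ ⟨b, x, rfl⟩
  exact DFunLike.congr_fun (h b) x

/-- A non-degenerate representation of a Banach algebra with a bounded approximate left identity
extends to the left multipliers. -/
theorem exists_extension [CompleteSpace X] (hB : HasBoundedApproxLeftId B) :
    ∃ K : ℝ, 0 ≤ K ∧ ∀ L : B →L[𝕜] B, IsLeftMultiplier L →
      ∃ S : X →L[𝕜] X, (∀ b, S * T b = T (L b)) ∧ ‖S‖ ≤ K * ‖L‖ := by
  obtain ⟨l, hl, ⟨M, hM⟩, hu⟩ := hB
  refine ⟨‖T‖ * max M 0, by positivity, fun L hL => ?_⟩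
  set V := Submodule.span 𝕜 {y : X | ∃ b x, T b x = y}
  have hlim₀ : ∀ b x, Filter.Tendsto (fun u => T (L u) (T b x)) l (𝓝 (T (L b) x)) := by
    intro b x
    have e : ∀ u, T (L u) (T b x) = T (L (u * b)) x := fun u => by
      rw [hL, hT.map_mul]; rfl
    simp only [e]
    exact (((T.continuous.comp L.continuous).clm_apply continuous_const).tendsto b).comp (hu b)
  -- Defining the operator as a limit makes it independent of how a vector is written as a sum of
  -- vectors `T b x`.
  have hlim : ∀ x : V, ∃ y, Filter.Tendsto (fun u => T (L u) (x : X)) l (𝓝 y) := by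
    rintro ⟨x, hx⟩
    induction hx using Submodule.span_induction with
    | mem x hx => obtain ⟨b, x, rfl⟩ := hx; exact ⟨_, hlim₀ b x⟩
    | zero => exact ⟨0, by simp⟩
    | add x y _ _ hx hy =>
      obtain ⟨x', hx⟩ := hx
      obtain ⟨y', hy⟩ := hy
      exact ⟨x' + y', by simpa using hx.add hy⟩
    | smul c x _ hx =>
      obtain ⟨x', hx⟩ := hx
      exact ⟨c • x', by simpa using hx.const_smul c⟩
  choose g hg using hlim
  let g₀ : V →ₗ[𝕜] X :=
    { toFun := g
      map_add' := fun x y => tendsto_nhds_unique (hg _) (by simpa using (hg x).add (hg y))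
      map_smul' := fun c x => tendsto_nhds_unique (hg _) (by simpa using (hg x).const_smul c) }
  -- The factor in front of `‖L‖` does not depend on `L`. Families of multipliers therefore extend
  -- with uniform control, which later yields boundedness of `π` and local boundedness of `U`.
  have hbound : ∀ x, ‖g₀ x‖ ≤ ‖T‖ * max M 0 * ‖L‖ * ‖x‖ := by
    intro x
    refine le_of_tendsto (hg x).norm ?_
    filter_upwards [hM] with u hu
    calc ‖T (L u) (x : X)‖ ≤ ‖T (L u)‖ * ‖(x : X)‖ := (T (L u)).le_opNorm _
      _ ≤ (‖T‖ * (‖L‖ * max M 0)) * ‖x‖ := by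
        gcongr
        · exact T.le_of_opNorm_le_of_le le_rfl
            (L.le_of_opNorm_le_of_le le_rfl (hu.trans (le_max_left _ _)))
        · exact le_rfl
      _ = _ := by ring
  let g₁ : V →L[𝕜] X := g₀.mkContinuous _ hbound
  have hV : DenseRange V.subtypeL := by
    have : Set.range V.subtypeL = V := by ext; simp
    rw [DenseRange, this]
    exact hT.dense
  refine ⟨g₁.extend V.subtypeL, fun b => ?_, ?_⟩
  · ext x
    have hx : T b x ∈ V := Submodule.subset_span ⟨b, x, rfl⟩
    have : g₁.extend V.subtypeL (V.subtypeL ⟨T b x, hx⟩) = g₁ ⟨T b x, hx⟩ :=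
      g₁.extend_eq hV isUniformEmbedding_subtype_val.isUniformInducing _
    exact this.trans (tendsto_nhds_unique (hg _) (hlim₀ b x))
  · refine (ContinuousLinearMap.opNorm_extend_le (N := 1) g₁ hV fun x => by simp).trans ?_
    rw [NNReal.coe_one, one_mul]
    exact g₀.mkContinuous_norm_le (by positivity) hbound

/-- The extension to left multipliers turns a bounded representation of `C` by left multipliers into
a bounded representation on `X`. -/
theorem exists_extension_rep [CompleteSpace X] (hB : HasBoundedApproxLeftId B)
    (Λ : C →L[𝕜] (B →L[𝕜] B)) (hΛ : ∀ c, IsLeftMultiplier (Λ c))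
    (hmul : ∀ c d, Λ (c * d) = Λ c * Λ d) :
    ∃ S : C →L[𝕜] (X →L[𝕜] X), (∀ c b, S c * T b = T (Λ c b)) ∧
      ∀ c d, S (c * d) = S c * S d := by
  obtain ⟨K, hK, h⟩ := hT.exists_extension hB
  choose S hS hSn using fun c => h (Λ c) (hΛ c)
  -- The operators `S c` are chosen separately for each `c`; linearity and multiplicativity in `c`
  -- follow because an operator is determined by its products with all `T b`.
  let S₀ : C →ₗ[𝕜] (X →L[𝕜] X) :=
    { toFun := S
      map_add' := fun c d => hT.ext fun b => by rw [add_mul, hS, hS, hS]; simp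
      map_smul' := fun r c => hT.ext fun b => by
        rw [RingHom.id_apply, smul_mul_assoc, hS, hS]; simp }
  refine ⟨S₀.mkContinuous (K * ‖Λ‖) fun c => (hSn c).trans ?_, hS, fun c d => ?_⟩
  · rw [mul_assoc]
    exact mul_le_mul_of_nonneg_left (Λ.le_opNorm c) hK
  · refine hT.ext fun b => ?_
    change S (c * d) * T b = S c * S d * T b
    rw [hS, mul_assoc, hS, hS, hmul]
    rfl

/-- If `S c T(b) = T(c · b)` and `c · b → b` along some filter, then `S` is non-degenerate. -/
theorem dense_of_tendsto {S : C → X →L[𝕜] X} {Λ : C → B →L[𝕜] B}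
    (h : ∀ c b, S c * T b = T (Λ c b)) {l : Filter C} [l.NeBot]
    (hl : ∀ b, Filter.Tendsto (fun u => Λ u b) l (𝓝 b)) :
    Dense (Submodule.span 𝕜 {y : X | ∃ c x, S c x = y} : Set X) := by
  rw [Submodule.dense_iff_topologicalClosure_eq_top, eq_top_iff,
    ← Submodule.dense_iff_topologicalClosure_eq_top.1 hT.dense]
  refine Submodule.topologicalClosure_minimal _ (Submodule.span_le.2 ?_)
    (Submodule.isClosed_topologicalClosure _)
  rintro _ ⟨b, x, rfl⟩
  -- Each `T b x` is the limit of `S u (T b x) = T (Λ u b) x`, hence lies in the closed span of the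
  -- ranges of the `S c`.
  refine mem_closure_of_tendsto (b := l) (f := fun u => S u (T b x)) ?_
    (Filter.Eventually.of_forall fun u => Submodule.subset_span ⟨u, _, rfl⟩)
  have : ∀ u, S u (T b x) = T (Λ u b) x := fun u => DFunLike.congr_fun (h u b) x
  simp only [this]
  exact ((T.continuous.clm_apply continuous_const).tendsto b).comp (hl b)

/-- An operator that commutes with `T` commutes with the extension of `T` to left multipliers. -/
theorem commute_extension {S V : X →L[𝕜] X} {L : B → B} (h : ∀ b, S * T b = T (L b))
    (hV : ∀ b, Commute V (T b)) : Commute V S := by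
  -- `V S T(b) = V T(L b) = T(L b) V = S T(b) V = S V T(b)`.
  refine hT.ext fun b => ?_
  rw [mul_assoc, h, (hV _).eq, ← h, mul_assoc, ← (hV b).eq, mul_assoc]

end IsNondegenerateBoundedRep

end Multiplier

/-! ### Bounded operators on completions -/

namespace BanachCompletion

variable {𝕜 : Type*} [RCLike 𝕜] {E : Type*} [NonUnitalSeminormedRing E] [NormedSpace 𝕜 E]

theorem ext_of {F : Type*} [NormedAddCommGroup F] [NormedSpace 𝕜 F] {S T : BanachCompletion E →L[𝕜] F}
    (h : ∀ x, S (of x) = T (of x)) : S = T :=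
  ContinuousLinearMap.coeFn_injective
    (denseRange_of.equalizer S.continuous T.continuous (funext h))

theorem norm_le_of {F : Type*} [NormedAddCommGroup F] [NormedSpace 𝕜 F]
    {S : BanachCompletion E →L[𝕜] F} {M : ℝ} (hM : 0 ≤ M) (h : ∀ x, ‖S (of x)‖ ≤ M * ‖x‖) :
    ‖S‖ ≤ M := by
  refine S.opNorm_le_bound hM fun b => ?_
  refine denseRange_of.induction_on (p := fun b => ‖S b‖ ≤ M * ‖b‖) b
    (isClosed_le (by fun_prop) (by fun_prop)) fun x => ?_
  rw [norm_of]
  exact h x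

/-- The operator on the completion induced by a bounded operator on `E`. -/
noncomputable def map (T : E →L[𝕜] E) : BanachCompletion E →L[𝕜] BanachCompletion E :=
  extend ((ofL 𝕜 E).comp T)

theorem map_of (T : E →L[𝕜] E) (x : E) : map T (of x) = of (T x) :=
  extend_of _ x

theorem norm_map_le (T : E →L[𝕜] E) : ‖map T‖ ≤ ‖T‖ :=
  norm_le_of (norm_nonneg _) fun x => by rw [map_of, norm_of]; exact T.le_opNorm x

theorem map_add (S T : E →L[𝕜] E) : map (S + T) = map S + map T :=
  ext_of fun x => by simp [map_of, of_add]

theorem map_smul (c : 𝕜) (T : E →L[𝕜] E) : map (c • T) = c • map T :=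
  ext_of fun x => by simp [map_of, of_smul]

/-- `T ↦ map T` as a bounded linear map. -/
noncomputable def mapL : (E →L[𝕜] E) →L[𝕜] (BanachCompletion E →L[𝕜] BanachCompletion E) :=
  LinearMap.mkContinuous ⟨⟨map, map_add⟩, map_smul⟩ 1 fun T => by
    rw [one_mul]; exact norm_map_le T

end BanachCompletion

/-! ### Representations of projective tensor products -/

section CommutingProducts

variable {M ι : Type*} [Monoid M]

/-- Each `g i` is moved to the right past the remaining `f j`. Absence of repetitions guarantees `j
≠ i` there, so `f i` and `g i` need not commute. -/
theorem List.prod_map_mul_of_commute {l : List ι} (hl : l.Nodup) {f g : ι → M}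
    (h : ∀ i j, i ≠ j → Commute (g i) (f j)) :
    (l.map fun i => f i * g i).prod = (l.map f).prod * (l.map g).prod := by
  induction l with
  | nil => simp
  | cons i l ih =>
    rw [List.nodup_cons] at hl
    have hc : Commute (g i) (l.map f).prod := by
      refine Commute.list_prod_right _ _ fun x hx => ?_
      obtain ⟨j, hj, rfl⟩ := List.mem_map.1 hx
      exact h i j fun e => hl.1 (e ▸ hj)
    simp only [List.map_cons, List.prod_cons, ih hl.2]
    rw [mul_assoc, ← mul_assoc (g i), hc.eq]
    simp only [mul_assoc]

end CommutingProducts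

section TensorReps

variable {𝕜 : Type*} [RCLike 𝕜] {n : ℕ} {B : Fin n → Type*} [∀ i, NonUnitalNormedRing (B i)]
  [∀ i, NormedSpace 𝕜 (B i)] [∀ i, IsScalarTower 𝕜 (B i) (B i)]
  [∀ i, SMulCommClass 𝕜 (B i) (B i)]

theorem elemTensor_mul (b c : ∀ i, B i) :
    elemTensor (𝕜 := 𝕜) b * elemTensor c = elemTensor (b * c) := by
  refine (BanachCompletion.of_mul _ _).symm.trans (congrArg BanachCompletion.of ?_)
  exact PiTensorProduct.mul_tprod_tprod _ _

theorem continuous_elemTensor : Continuous (elemTensor (𝕜 := 𝕜) : (∀ i, B i) → _) :=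
  BanachCompletion.continuous_of.comp (PiTensorProduct.tprodL 𝕜 (E := B)).cont

theorem norm_elemTensor_le (b : ∀ i, B i) : ‖elemTensor (𝕜 := 𝕜) b‖ ≤ ∏ i, ‖b i‖ :=
  (BanachCompletion.norm_of _).le.trans (PiTensorProduct.projectiveSeminorm_tprod_le b)

theorem ProjTensorProduct.dense_span_elemTensor :
    Dense (Submodule.span 𝕜 (Set.range (elemTensor (𝕜 := 𝕜) (B := B))) :
      Set (ProjTensorProduct 𝕜 B)) := by
  have h : Set.range (BanachCompletion.of (E := AlgTensorProduct 𝕜 B)) ⊆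
      Submodule.span 𝕜 (Set.range (elemTensor (𝕜 := 𝕜) (B := B))) := by
    rintro _ ⟨t, rfl⟩
    let F : (⨂[𝕜] i, B i) →ₗ[𝕜] ProjTensorProduct 𝕜 B :=
      (BanachCompletion.ofL 𝕜 (AlgTensorProduct 𝕜 B)).toLinearMap
    have ht : (t : ⨂[𝕜] i, B i) ∈ Submodule.span 𝕜 (Set.range (PiTensorProduct.tprod 𝕜)) := by
      rw [PiTensorProduct.span_tprod_eq_top]; trivial
    have := Submodule.mem_map_of_mem (f := F) ht
    rw [Submodule.map_span, ← Set.range_comp] at this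
    exact this
  exact BanachCompletion.denseRange_of.mono h

theorem ProjTensorProduct.ext {F : Type*} [NormedAddCommGroup F] [NormedSpace 𝕜 F]
    {S T : ProjTensorProduct 𝕜 B →L[𝕜] F} (h : ∀ b, S (elemTensor b) = T (elemTensor b)) : S = T :=
  ContinuousLinearMap.ext_on ProjTensorProduct.dense_span_elemTensor
    (by rintro _ ⟨b, rfl⟩; exact h b)

/-- The operator on the projective tensor product that applies `L` to the `i`-th factor. -/
noncomputable def factorOp (i : Fin n) : (B i →L[𝕜] B i) →L[𝕜]
    (ProjTensorProduct 𝕜 B →L[𝕜] ProjTensorProduct 𝕜 B) :=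
  (BanachCompletion.mapL (E := AlgTensorProduct 𝕜 B)).comp
    ((PiTensorProduct.mapLMultilinear 𝕜 B B).toContinuousLinearMap
      (fun _ => ContinuousLinearMap.id 𝕜 _) i)

theorem factorOp_elemTensor (i : Fin n) (L : B i →L[𝕜] B i) (b : ∀ i, B i) :
    factorOp i L (elemTensor b) = elemTensor (Function.update b i (L (b i))) := by
  refine (BanachCompletion.map_of _ _).trans (congrArg BanachCompletion.of ?_)
  refine (PiTensorProduct.mapL_apply _ _).trans ((PiTensorProduct.map_tprod _ _).trans ?_)
  congr 1
  funext j
  rcases eq_or_ne j i with rfl | h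
  · simp
  · simp [h]

/-- Left multiplication by `b` in the `i`-th factor of the projective tensor product. -/
noncomputable def factorMul (i : Fin n) :
    B i →L[𝕜] (ProjTensorProduct 𝕜 B →L[𝕜] ProjTensorProduct 𝕜 B) :=
  (factorOp i).comp (ContinuousLinearMap.mul 𝕜 (B i))

theorem factorMul_elemTensor (i : Fin n) (c : B i) (b : ∀ i, B i) :
    factorMul (𝕜 := 𝕜) i c (elemTensor b) = elemTensor (Function.update b i (c * b i)) :=
  factorOp_elemTensor i _ b

theorem factorMul_mul (i : Fin n) (c d : B i) :
    factorMul (𝕜 := 𝕜) i (c * d) = factorMul i c * factorMul i d :=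
  ProjTensorProduct.ext fun b => by
    rw [mul_apply_eq_comp, factorMul_elemTensor, factorMul_elemTensor,
      factorMul_elemTensor, Function.update_self, Function.update_idem, mul_assoc]

theorem factorMul_commute {i j : Fin n} (h : i ≠ j) (c : B i) (d : B j) :
    Commute (factorMul (𝕜 := 𝕜) i c) (factorMul j d) :=
  ProjTensorProduct.ext fun b => by
    rw [mul_apply_eq_comp, mul_apply_eq_comp, factorMul_elemTensor,
      factorMul_elemTensor, factorMul_elemTensor, factorMul_elemTensor,
      Function.update_of_ne h, Function.update_of_ne h.symm, Function.update_comm h]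

/-- Both sides are bounded and linear in each variable, so the identity extends from elementary
tensors first in `c` and then in `b`. -/
theorem ProjTensorProduct.isLeftMultiplier_of_elemTensor
    {L : ProjTensorProduct 𝕜 B →L[𝕜] ProjTensorProduct 𝕜 B}
    (h : ∀ b c, L (elemTensor b * elemTensor c) = L (elemTensor b) * elemTensor c) :
    IsLeftMultiplier L := by
  have h₁ : ∀ b, L.comp (ContinuousLinearMap.mul 𝕜 _ (elemTensor b)) =
      ContinuousLinearMap.mul 𝕜 _ (L (elemTensor b)) := fun b =>
    ProjTensorProduct.ext fun c => h b c
  have h₂ : ∀ c, L.comp ((ContinuousLinearMap.mul 𝕜 _).flip c) =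
      ((ContinuousLinearMap.mul 𝕜 _).flip c).comp L := fun c =>
    ProjTensorProduct.ext fun b => DFunLike.congr_fun (h₁ b) c
  exact fun b c => DFunLike.congr_fun (h₂ c) b

theorem isLeftMultiplier_factorMul (i : Fin n) (c : B i) :
    IsLeftMultiplier (factorMul (𝕜 := 𝕜) i c) := by
  refine ProjTensorProduct.isLeftMultiplier_of_elemTensor fun b d => ?_
  rw [elemTensor_mul, factorMul_elemTensor, factorMul_elemTensor, elemTensor_mul]
  congr 1
  funext j
  rcases eq_or_ne j i with rfl | h
  · simp [mul_assoc]
  · simp [h]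

/-- This recovers a representation of the tensor product from its extensions to the single factors.
-/
theorem factorMul_prod (b : ∀ i, B i) (t : ProjTensorProduct 𝕜 B) :
    (List.ofFn fun i => factorMul (𝕜 := 𝕜) i (b i)).prod t = elemTensor b * t := by
  -- The induction runs over partial products; without repetitions, each coordinate in `l` is
  -- multiplied exactly once.
  have key : ∀ l : List (Fin n), l.Nodup → ∀ c : ∀ i, B i,
      (l.map fun i => factorMul (𝕜 := 𝕜) i (b i)).prod (elemTensor c) =
        elemTensor fun j => if j ∈ l then b j * c j else c j := by
    intro l hl c
    induction l with
    | nil => simp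
    | cons i l ih =>
      rw [List.nodup_cons] at hl
      rw [List.map_cons, List.prod_cons, mul_apply_eq_comp, ih hl.2,
        factorMul_elemTensor]
      congr 1
      funext j
      rcases eq_or_ne j i with rfl | h
      · simp [hl.1]
      · simp [h]
  have : (List.ofFn fun i => factorMul (𝕜 := 𝕜) i (b i)).prod =
      ContinuousLinearMap.mul 𝕜 _ (elemTensor b) := by
    refine ProjTensorProduct.ext fun c => ?_
    rw [List.ofFn_eq_map, key _ (List.nodup_finRange n), ContinuousLinearMap.mul_apply',
      elemTensor_mul]
    congr 1
    funext j
    simp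
  rw [this]
  rfl

/-- Elementary tensors depend continuously on their `i`-th entry, and the operators are eventually
bounded, so density suffices. The result makes the extension to the `i`-th factor non-degenerate. -/
theorem tendsto_factorMul (i : Fin n) {l : Filter (B i)} {M : ℝ} (hM : ∀ᶠ u in l, ‖u‖ ≤ M)
    (hl : ∀ b, Filter.Tendsto (fun u => u * b) l (𝓝 b)) (t : ProjTensorProduct 𝕜 B) :
    Filter.Tendsto (fun u => factorMul (𝕜 := 𝕜) i u t) l (𝓝 t) := by
  refine tendsto_of_dense_span (M := ‖factorMul (𝕜 := 𝕜) (B := B) i‖ * M) ?_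
    ProjTensorProduct.dense_span_elemTensor ?_ t
  · filter_upwards [hM] with u hu
    exact (factorMul (𝕜 := 𝕜) (B := B) i).le_of_opNorm_le_of_le le_rfl hu
  · rintro _ ⟨b, rfl⟩
    simp only [factorMul_elemTensor]
    have h₁ : Continuous fun u => elemTensor (𝕜 := 𝕜) (Function.update b i u) :=
      continuous_elemTensor.comp (continuous_const.update i continuous_id)
    simpa [Function.comp_def] using (h₁.tendsto (b i)).comp (hl (b i))

/-- The tensors `u₁ ⊗ ⋯ ⊗ uₙ` along the product filter work: their norms are at most the product of
the individual bounds, and on elementary tensors convergence is coordinatewise. -/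
theorem ProjTensorProduct.hasBoundedApproxLeftId (hB : ∀ i, HasBoundedApproxLeftId (B i)) :
    HasBoundedApproxLeftId (ProjTensorProduct 𝕜 B) := by
  unfold HasBoundedApproxLeftId at hB
  choose l hl hM hu using hB
  choose M hM using hM
  have hM' : ∀ᶠ u in Filter.pi l, ‖elemTensor (𝕜 := 𝕜) u‖ ≤ ∏ i, max (M i) 0 := by
    have : ∀ᶠ u in Filter.pi l, ∀ i, ‖u i‖ ≤ M i :=
      Filter.eventually_all.2 fun i => (Filter.tendsto_eval_pi l i).eventually (hM i)
    filter_upwards [this] with u hu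
    exact (norm_elemTensor_le u).trans (Finset.prod_le_prod (fun i _ => norm_nonneg _)
      fun i _ => (hu i).trans (le_max_left _ _))
  refine ⟨(Filter.pi l).map (elemTensor (𝕜 := 𝕜)), inferInstance, ⟨∏ i, max (M i) 0, hM'⟩,
    fun t => ?_⟩
  rw [Filter.tendsto_map'_iff]
  refine tendsto_of_dense_span (S := fun u => ContinuousLinearMap.mul 𝕜 _ (elemTensor u))
    (M := ∏ i, max (M i) 0) ?_ ProjTensorProduct.dense_span_elemTensor ?_ t
  · filter_upwards [hM'] with u hu
    exact (ContinuousLinearMap.opNorm_mul_apply_le _ _ _).trans hu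
  · rintro _ ⟨b, rfl⟩
    simp only [ContinuousLinearMap.mul_apply', elemTensor_mul]
    refine (continuous_elemTensor.tendsto b).comp (tendsto_pi_nhds.2 fun i => ?_)
    exact (hu i (b i)).comp (Filter.tendsto_eval_pi l i)

variable {X : Type*} [NormedAddCommGroup X] [NormedSpace 𝕜 X] [CompleteSpace X]
  {T : ∀ i, B i →L[𝕜] (X →L[𝕜] X)}

theorem sunProduct_mul (hmul : ∀ i b c, T i (b * c) = T i b * T i c)
    (hT : ∀ i j, i ≠ j → ∀ b c, Commute (T i b) (T j c)) (s t : ProjTensorProduct 𝕜 B) :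
    sunProduct T (s * t) = sunProduct T s * sunProduct T t := by
  have h₀ : ∀ b c, sunProduct T (elemTensor b * elemTensor c) =
      sunProduct T (elemTensor b) * sunProduct T (elemTensor c) := by
    intro b c
    simp only [elemTensor_mul, sunProduct_elemTensor, List.ofFn_eq_map, Pi.mul_apply, hmul]
    exact List.prod_map_mul_of_commute (List.nodup_finRange n) fun i j h => hT i j h _ _
  have h₁ : ∀ b, (sunProduct T).comp (ContinuousLinearMap.mul 𝕜 _ (elemTensor b)) =
      (ContinuousLinearMap.mul 𝕜 _ (sunProduct T (elemTensor b))).comp (sunProduct T) := fun b =>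
    ProjTensorProduct.ext fun c => h₀ b c
  have h₂ : ∀ c, (sunProduct T).comp ((ContinuousLinearMap.mul 𝕜 _).flip c) =
      ((ContinuousLinearMap.mul 𝕜 _).flip (sunProduct T c)).comp (sunProduct T) := fun c =>
    ProjTensorProduct.ext fun b => DFunLike.congr_fun (h₁ b) c
  exact DFunLike.congr_fun (h₂ t) s

/-- Factors are peeled off from the right. If `P T_i(c) y` lies in the closed subspace `Y` for all
`c` and `y`, then so does `P x` for every `x`, since the vectors `T_i(c) y` span densely. Once all
factors are gone, `Y` is everything. -/
theorem sunProduct_dense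
    (hT : ∀ i, Dense (Submodule.span 𝕜 {y : X | ∃ b x, T i b x = y} : Set X)) :
    Dense (Submodule.span 𝕜 {y : X | ∃ t x, sunProduct T t x = y} : Set X) := by
  set Y := (Submodule.span 𝕜 {y : X | ∃ t x, sunProduct T t x = y}).topologicalClosure
  have key : ∀ l₂ l₁ : List (Fin n), l₁ ++ l₂ = List.finRange n → ∀ (b : ∀ i, B i) (x : X),
      (l₁.map fun i => T i (b i)).prod x ∈ Y := by
    intro l₂
    induction l₂ with
    | nil =>
      intro l₁ h b x
      rw [List.append_nil] at h
      refine Submodule.le_topologicalClosure _ (Submodule.subset_span ⟨elemTensor b, x, ?_⟩)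
      rw [sunProduct_elemTensor, List.ofFn_eq_map, h]
    | cons i l₂ ih =>
      intro l₁ h b x
      have hi : i ∉ l₁ := by
        have := h ▸ List.nodup_finRange n
        rw [List.nodup_append] at this
        exact fun hi => this.2.2 i hi i (by simp) rfl
      set P := (l₁.map fun i => T i (b i)).prod
      have hle : (Submodule.span 𝕜 {y : X | ∃ b x, T i b x = y}).topologicalClosure ≤
          Y.comap (P : X →ₗ[𝕜] X) := by
        refine Submodule.topologicalClosure_minimal _ (Submodule.span_le.2 ?_)
          ((Submodule.isClosed_topologicalClosure _).preimage P.continuous)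
        rintro _ ⟨c, y, rfl⟩
        -- Changing the `i`-th entry to `c` leaves `P` unchanged, because `i` does not occur in
        -- `l₁`.
        have := ih (l₁ ++ [i]) (by simpa using h) (Function.update b i c) y
        rw [List.map_append, List.prod_append] at this
        have e : l₁.map (fun j => T j (Function.update b i c j)) = l₁.map fun j => T j (b j) :=
          List.map_congr_left fun j hj => by
            rw [Function.update_of_ne (ne_of_mem_of_not_mem hj hi)]
        rw [e] at this
        simpa using this
      rw [Submodule.dense_iff_topologicalClosure_eq_top.1 (hT i)] at hle
      exact hle trivial
  rw [Submodule.dense_iff_topologicalClosure_eq_top, eq_top_iff]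
  exact fun x _ => by simpa using key _ [] rfl 0 x

/-- The product of commuting non-degenerate bounded representations is non-degenerate. -/
theorem isNondegenerateBoundedRep_sunProduct (hT : ∀ i, IsNondegenerateBoundedRep (T i))
    (hc : ∀ i j, i ≠ j → ∀ b c, Commute (T i b) (T j c)) :
    IsNondegenerateBoundedRep (sunProduct T) :=
  ⟨sunProduct_mul (fun i => (hT i).map_mul) hc, sunProduct_dense fun i => (hT i).dense⟩

/-- `T i c` commutes past the factors `T j` with `j ≠ i` and is absorbed by the `i`-th one. Thus `T
i` is the extension of the product representation to the multipliers `factorMul i`, and so is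
determined by it. -/
theorem mul_sunProduct (hmul : ∀ i b c, T i (b * c) = T i b * T i c)
    (hT : ∀ i j, i ≠ j → ∀ b c, Commute (T i b) (T j c)) (i : Fin n) (c : B i)
    (t : ProjTensorProduct 𝕜 B) : T i c * sunProduct T t = sunProduct T (factorMul i c t) := by
  have key : ∀ l : List (Fin n), l.Nodup → i ∈ l → ∀ b : ∀ i, B i,
      T i c * (l.map fun j => T j (b j)).prod =
        (l.map fun j => T j (Function.update b i (c * b i) j)).prod := by
    intro l hl hi b
    induction l with
    | nil => simp at hi
    | cons j l ih =>
      rw [List.nodup_cons] at hl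
      rw [List.map_cons, List.map_cons, List.prod_cons, List.prod_cons, ← mul_assoc]
      rcases eq_or_ne i j with rfl | h
      · rw [Function.update_self, hmul]
        congr 2
        exact List.map_congr_left fun j hj => by
          rw [Function.update_of_ne (ne_of_mem_of_not_mem hj hl.1)]
      · rw [(hT i j h _ _).eq, mul_assoc, ih hl.2 (List.mem_of_ne_of_mem h hi),
          Function.update_of_ne h.symm]
  have : (ContinuousLinearMap.mul 𝕜 _ (T i c)).comp (sunProduct T) =
      (sunProduct T).comp (factorMul i c) := ProjTensorProduct.ext fun b => by
    simpa [sunProduct_elemTensor, factorMul_elemTensor, List.ofFn_eq_map] using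
      key _ (List.nodup_finRange n) (List.mem_finRange i) b
  exact DFunLike.congr_fun this t

/-- Commuting non-degenerate bounded representations are determined by their product. -/
theorem sunProduct_injective {S : ∀ i, B i →L[𝕜] (X →L[𝕜] X)}
    (hT : ∀ i, IsNondegenerateBoundedRep (T i)) (hS : ∀ i, IsNondegenerateBoundedRep (S i))
    (hTc : ∀ i j, i ≠ j → ∀ b c, Commute (T i b) (T j c))
    (hSc : ∀ i j, i ≠ j → ∀ b c, Commute (S i b) (S j c)) (h : sunProduct T = sunProduct S) :
    T = S := by
  funext i
  ext1 c
  refine (isNondegenerateBoundedRep_sunProduct hT hTc).ext fun t => ?_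
  rw [mul_sunProduct (fun i => (hT i).map_mul) hTc, h,
    mul_sunProduct (fun i => (hS i).map_mul) hSc]

/-- Every non-degenerate bounded representation of a projective tensor product is a product of
commuting non-degenerate bounded representations of the factors. -/
theorem IsNondegenerateBoundedRep.exists_eq_sunProduct
    (hB : ∀ i, HasBoundedApproxLeftId (B i)) {T : ProjTensorProduct 𝕜 B →L[𝕜] (X →L[𝕜] X)}
    (hT : IsNondegenerateBoundedRep T) :
    ∃ S : ∀ i, B i →L[𝕜] (X →L[𝕜] X), (∀ i, IsNondegenerateBoundedRep (S i)) ∧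
      (∀ i j, i ≠ j → ∀ b c, Commute (S i b) (S j c)) ∧ sunProduct S = T := by
  have hB' := ProjTensorProduct.hasBoundedApproxLeftId (𝕜 := 𝕜) hB
  choose S hS hSmul using fun i => hT.exists_extension_rep hB' (factorMul i)
    (isLeftMultiplier_factorMul i) (factorMul_mul i)
  refine ⟨S, fun i => ⟨hSmul i, ?_⟩, fun i j h b c => ?_, ?_⟩
  · obtain ⟨l, hl, ⟨M, hM⟩, hu⟩ := hB i
    exact hT.dense_of_tendsto (hS i) (tendsto_factorMul i hM hu)
  · refine hT.ext fun t => ?_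
    rw [mul_assoc, hS, hS, mul_assoc, hS, hS]
    exact congrArg T (DFunLike.congr_fun (factorMul_commute h b c) t)
  -- `S₁(b₁) ⋯ Sₙ(bₙ) T(t)` is `T` of the successive factor multiplications applied to `t`, that is
  -- `T(b₁ ⊗ ⋯ ⊗ bₙ) T(t)`.
  · refine ProjTensorProduct.ext fun b => hT.ext fun t => ?_
    rw [sunProduct_elemTensor, ← hT.map_mul, ← factorMul_prod, List.ofFn_eq_map, List.ofFn_eq_map]
    generalize List.finRange n = l
    induction l with
    | nil => simp
    | cons i l ih =>
      rw [List.map_cons, List.prod_cons, mul_assoc, ih, hS, List.map_cons, List.prod_cons]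
      rfl

end TensorReps

/-! ### Strong continuity and approximate identities -/

section StrongContinuity

variable {𝕜 G X : Type*} [RCLike 𝕜] [Group G] [TopologicalSpace G] [IsTopologicalGroup G]
  [NormedAddCommGroup X] [NormedSpace 𝕜 X]

/-- A representation that is bounded near `1` and strongly continuous at `1` on a set with dense span
is strongly continuous. -/
theorem continuous_of_tendsto_one {U : G →* (X →L[𝕜] X)} {M : ℝ} (hM : ∀ᶠ r in 𝓝 1, ‖U r‖ ≤ M)
    {s : Set X} (hs : Dense (Submodule.span 𝕜 s : Set X))
    (h : ∀ x ∈ s, Filter.Tendsto (fun r => U r x) (𝓝 1) (𝓝 x)) (x : X) :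
    Continuous fun r => U r x := by
  rw [continuous_iff_continuousAt]
  intro r₀
  have h₁ := tendsto_of_dense_span hM hs h x
  have h₂ : Filter.Tendsto (fun r => r₀⁻¹ * r) (𝓝 r₀) (𝓝 1) := by
    have : Continuous fun r => r₀⁻¹ * r := by fun_prop
    simpa using this.tendsto r₀
  have h₃ := ((U r₀).continuous.tendsto x).comp (h₁.comp h₂)
  refine h₃.congr fun r => ?_
  change (U r₀ * U (r₀⁻¹ * r)) x = U r x
  rw [← map_mul, mul_inv_cancel_left]

/-- A bounded approximate left identity converges uniformly on compact sets. -/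
theorem eventually_forall_norm_mul_sub_lt {A : Type*} [NonUnitalNormedRing A] {l : Filter A} {M : ℝ}
    (hM : ∀ᶠ u in l, ‖u‖ ≤ M) (hl : ∀ a, Filter.Tendsto (fun u => u * a) l (𝓝 a)) {S : Set A}
    (hS : IsCompact S) {ε : ℝ} (hε : 0 < ε) : ∀ᶠ u in l, ∀ a ∈ S, ‖u * a - a‖ < ε := by
  have hδ : 0 < ε / (max M 0 + 2) := by positivity
  -- Convergence is only needed at finitely many centres; boundedness of `u` transfers it to the
  -- surrounding balls.
  obtain ⟨t, -, ht, hcover⟩ := hS.finite_cover_balls hδ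
  have := (Filter.eventually_all_finite ht).2 fun b _ => Metric.tendsto_nhds.1 (hl b) _ hδ
  filter_upwards [hM, this] with u hu hut a ha
  obtain ⟨b, hb, hab⟩ := Set.mem_iUnion₂.1 (hcover ha)
  have h₁ := hut b hb
  rw [Metric.mem_ball] at hab
  rw [dist_eq_norm] at hab h₁
  have e : u * a - a = u * (a - b) + (u * b - b) - (a - b) := by rw [mul_sub]; abel
  have h₂ : ‖u * (a - b)‖ ≤ max M 0 * (ε / (max M 0 + 2)) :=
    (norm_mul_le _ _).trans (mul_le_mul (hu.trans (le_max_left _ _)) hab.le (norm_nonneg _)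
      (le_max_right _ _))
  calc ‖u * a - a‖ ≤ ‖u * (a - b)‖ + ‖u * b - b‖ + ‖a - b‖ := by
        rw [e]; exact (norm_sub_le _ _).trans (by gcongr; exact norm_add_le _ _)
    _ < max M 0 * (ε / (max M 0 + 2)) + ε / (max M 0 + 2) + ε / (max M 0 + 2) := by
        linarith
    _ = ε := by field_simp; ring

end StrongContinuity

/-! ### Bump functions shrinking to the identity -/

section Bumps

variable {G : Type*} [Group G] [TopologicalSpace G] [IsTopologicalGroup G] [LocallyCompactSpace G]
  [MeasurableSpace G] [BorelSpace G] (μ : Measure G)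

/-- The non-negative compactly supported continuous functions with integral one that vanish
outside `V`. -/
def bumpFunctions (V : Set G) : Set C_c(G, ℝ) :=
  {z | (∀ s, 0 ≤ z s) ∧ (∀ s, s ∉ V → z s = 0) ∧ ∫ s, z s ∂μ = 1}

theorem monotone_bumpFunctions : Monotone (bumpFunctions μ) :=
  fun _ _ h _ hz => ⟨hz.1, fun s hs => hz.2.1 s fun hs' => hs (h hs'), hz.2.2⟩

/-- A Urysohn function that is `1` at the identity has positive integral, since open sets have
positive measure; it is divided by that integral. -/
theorem bumpFunctions_nonempty [IsFiniteMeasureOnCompacts μ] [μ.IsOpenPosMeasure] {V : Set G}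
    (hV : V ∈ 𝓝 1) : (bumpFunctions μ V).Nonempty := by
  obtain ⟨f, hf₁, hfc, hfV, hf₀⟩ := exists_continuousMap_one_of_isCompact_subset_isOpen
    (isCompact_singleton (x := (1 : G))) isOpen_interior
    (Set.singleton_subset_iff.2 (mem_interior_iff_mem_nhds.2 hV))
  have hpos : 0 < ∫ s, f s ∂μ :=
    f.continuous.integral_pos_of_hasCompactSupport_nonneg_nonzero hfc (fun s => (hf₀ s).1)
      (x := 1) (by rw [hf₁ rfl]; exact one_ne_zero)
  let z : C_c(G, ℝ) := ⟨f, hfc⟩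
  have hz : ∀ s, ((∫ s, f s ∂μ)⁻¹ • z) s = (∫ s, f s ∂μ)⁻¹ * f s := fun _ => rfl
  refine ⟨(∫ s, f s ∂μ)⁻¹ • z, fun s => ?_, fun s hs => ?_, ?_⟩
  · rw [hz]
    exact mul_nonneg (inv_nonneg.2 hpos.le) (hf₀ s).1
  · rw [hz, image_eq_zero_of_notMem_tsupport fun h => hs (interior_subset (hfV h)), mul_zero]
  · simp only [hz]
    rw [integral_const_mul, inv_mul_cancel₀ hpos.ne']

/-- The filter of bump functions whose supports shrink to `1`. -/
def bumpFilter : Filter C_c(G, ℝ) := (𝓝 1).lift' (bumpFunctions μ)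

instance [IsFiniteMeasureOnCompacts μ] [μ.IsOpenPosMeasure] : (bumpFilter μ).NeBot :=
  (Filter.lift'_neBot_iff (monotone_bumpFunctions μ)).2 fun _ hV => bumpFunctions_nonempty μ hV

theorem eventually_bumpFilter {V : Set G} (hV : V ∈ 𝓝 1) :
    ∀ᶠ z in bumpFilter μ, z ∈ bumpFunctions μ V :=
  Filter.mem_lift' hV

end Bumps

/-! ### Translations, pointwise multiplication and bumps under integrated forms -/

section Crossed

variable {𝕜 A G : Type*} [RCLike 𝕜] [NonUnitalNormedRing A] [NormedSpace 𝕜 A]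
  [IsScalarTower 𝕜 A A] [SMulCommClass 𝕜 A A] [CompleteSpace A] [Group G]
  [TopologicalSpace G] [IsTopologicalGroup G] [LocallyCompactSpace G] [T2Space G]
  [MeasurableSpace G] [BorelSpace G] {α : BanachDynamicalSystem 𝕜 A G}

/-- The function `s ↦ z(s) u`. -/
noncomputable def bumpTensor (𝕜 : Type*) [RCLike 𝕜] [NormedSpace 𝕜 A] (z : C_c(G, ℝ)) (u : A) :
    C_c(G, A) where
  toFun s := (z s : 𝕜) • u
  continuous_toFun := (RCLike.continuous_ofReal.comp z.continuous).smul continuous_const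
  hasCompactSupport' := HasCompactSupport.intro z.hasCompactSupport.isCompact fun s hs => by
    rw [image_eq_zero_of_notMem_tsupport hs]; simp

theorem bumpTensor_apply (z : C_c(G, ℝ)) (u : A) (s : G) :
    bumpTensor 𝕜 z u s = (z s : 𝕜) • u := rfl

/-- Pointwise left multiplication by `a` on `C_c(G, A)`. -/
noncomputable def pointwiseMul (a : A) (f : C_c(G, A)) : C_c(G, A) where
  toFun s := a * f s
  continuous_toFun := continuous_const.mul f.continuous
  hasCompactSupport' := HasCompactSupport.intro f.hasCompactSupport.isCompact fun s hs => by
    rw [image_eq_zero_of_notMem_tsupport hs, mul_zero]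

theorem pointwiseMul_apply (a : A) (f : C_c(G, A)) (s : G) : pointwiseMul a f s = a * f s := rfl

namespace BanachDynamicalSystem

theorem continuous_translate_uncurry (α : BanachDynamicalSystem 𝕜 A G) (f : C_c(G, A)) :
    Continuous fun p : G × G => α.act p.1 (f (p.1⁻¹ * p.2)) :=
  continuous_strong α.continuous_act continuous_fst
    (f.continuous.comp (continuous_fst.inv.mul continuous_snd))

theorem translate_eq_zero (α : BanachDynamicalSystem 𝕜 A G) (f : C_c(G, A)) {N : Set G} {r t : G}
    (hr : r ∈ N) (ht : t ∉ N * tsupport f) : α.act r (f (r⁻¹ * t)) = 0 := by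
  rw [image_eq_zero_of_notMem_tsupport fun h => ht ⟨r, hr, r⁻¹ * t, h, by simp⟩, map_zero]

/-- The translation `t ↦ α_r(f(r⁻¹ t))` on `C_c(G, A)`. -/
noncomputable def translate (α : BanachDynamicalSystem 𝕜 A G) (r : G) (f : C_c(G, A)) :
    C_c(G, A) where
  toFun t := α.act r (f (r⁻¹ * t))
  continuous_toFun := (α.continuous_translate_uncurry f).comp (continuous_const.prodMk continuous_id)
  hasCompactSupport' := HasCompactSupport.intro
    ((isCompact_singleton (x := r)).mul f.hasCompactSupport.isCompact) fun _ ht =>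
      α.translate_eq_zero f (Set.mem_singleton r) ht

theorem translate_apply (α : BanachDynamicalSystem 𝕜 A G) (r : G) (f : C_c(G, A)) (t : G) :
    α.translate r f t = α.act r (f (r⁻¹ * t)) := rfl

end BanachDynamicalSystem

namespace ContCovariantRep

variable {X : Type*} [NormedAddCommGroup X] [NormedSpace 𝕜 X] [CompleteSpace X]
  (ρ : ContCovariantRep α X) (μ : Measure G) [IsFiniteMeasureOnCompacts μ]

theorem integratedForm_pointwiseMul (a : A) (f : C_c(G, A)) :
    ρ.integratedForm μ (pointwiseMul a f) = ρ.π a * ρ.integratedForm μ f := by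
  ext x
  rw [mul_apply_eq_comp, integratedForm_apply, integratedForm_apply,
    ← vecIntegral_clm (ρ.π a) (ρ.continuous_integrand f x) (ρ.compactSupport_integrand f x)]
  simp only [pointwiseMul_apply, map_mul]
  rfl

/-- Left invariance allows the substitution `s ↦ r⁻¹ s`, and covariance turns `U_r π(a) U_{r⁻¹}`
into `π(α_r a)`. -/
theorem integratedForm_translate [μ.IsMulLeftInvariant] (r : G) (f : C_c(G, A)) :
    ρ.integratedForm μ (α.translate r f) = ρ.U r * ρ.integratedForm μ f := by
  ext x
  rw [mul_apply_eq_comp, integratedForm_apply, integratedForm_apply,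
    ← vecIntegral_clm (ρ.U r) (ρ.continuous_integrand f x) (ρ.compactSupport_integrand f x),
    ← vecIntegral_shift (fun s => ρ.U r (ρ.π (f s) (ρ.U s x))) r]
  congr 1
  funext t
  rw [BanachDynamicalSystem.translate_apply, ρ.covariant]
  change _ = (ρ.U r * ρ.π (f (r⁻¹ * t)) * ρ.U (r⁻¹ * t)) x
  rw [map_mul ρ.U]
  rfl

/-- An operator that commutes with `π` and `U` commutes with `π ⋊ U`. -/
theorem commute_integratedForm {S : X →L[𝕜] X} (hπ : ∀ a, Commute S (ρ.π a))
    (hU : ∀ s, Commute S (ρ.U s)) (f : C_c(G, A)) : Commute S (ρ.integratedForm μ f) := by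
  ext x
  rw [mul_apply_eq_comp, mul_apply_eq_comp, integratedForm_apply, integratedForm_apply,
    ← vecIntegral_clm S (ρ.continuous_integrand f x) (ρ.compactSupport_integrand f x)]
  congr 1
  funext s
  change (S * (ρ.π (f s) * ρ.U s)) x = (ρ.π (f s) * ρ.U s * S) x
  rw [((hπ _).mul_right (hU s)).eq]

theorem tendsto_π (hρ : ρ.IsNondegenerate) {l : Filter A} {M : ℝ} (hM : ∀ᶠ u in l, ‖u‖ ≤ M)
    (hl : ∀ a, Filter.Tendsto (fun u => u * a) l (𝓝 a)) (x : X) :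
    Filter.Tendsto (fun u => ρ.π u x) l (𝓝 x) := by
  refine tendsto_of_dense_span (S := fun u => ρ.π u) (M := ‖ρ.πL‖ * M) ?_ hρ ?_ x
  · filter_upwards [hM] with u hu
    exact ρ.πL.le_of_opNorm_le_of_le le_rfl hu
  · rintro _ ⟨a, y, rfl⟩
    have : ∀ u, ρ.π u (ρ.π a y) = ρ.πL (u * a) y := fun u => by
      rw [πL_apply, map_mul]; rfl
    simp only [this]
    exact ((ρ.πL.continuous.clm_apply continuous_const).tendsto a).comp (hl a)

/-- The integrand of the difference is `z(s) (π(u)(U_s x - x) + (π(u) x - x))`. The first term is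
small for `s` near `1` uniformly in bounded `u`, the second for `u` far along `l`, so `z` and `u`
may vary independently. The lemma serves both for non-degeneracy of induced representations and,
applied to `canonicalRep`, for the approximate identity of the crossed product. -/
theorem tendsto_integratedForm_bumpTensor {l : Filter A} {M : ℝ} (hM : ∀ᶠ u in l, ‖u‖ ≤ M)
    (hl : ∀ x, Filter.Tendsto (fun u => ρ.π u x) l (𝓝 x)) (x : X) :
    Filter.Tendsto (fun p : C_c(G, ℝ) × A => ρ.integratedForm μ (bumpTensor 𝕜 p.1 p.2) x)
      (bumpFilter μ ×ˢ l) (𝓝 x) := by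
  let _ : NormedSpace ℝ X := NormedSpace.restrictScalars ℝ 𝕜 X
  obtain ⟨C, hC, hπ⟩ := ρ.exists_bound
  rw [Metric.tendsto_nhds]
  intro ε hε
  -- The factor `C * max M 0` bounds `‖π u‖`; keeping it in the condition avoids dividing by a
  -- constant that may vanish.
  have hV : {r | C * max M 0 * ‖ρ.U r x - x‖ < ε / 4} ∈ 𝓝 (1 : G) := by
    have hc : Continuous fun r => C * max M 0 * ‖ρ.U r x - x‖ :=
      continuous_const.mul ((ρ.continuous x).sub continuous_const).norm
    refine (isOpen_lt hc continuous_const).mem_nhds ?_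
    simpa using by positivity
  have hu : ∀ᶠ u in l, ‖u‖ ≤ M ∧ ‖ρ.π u x - x‖ < ε / 4 := by
    filter_upwards [hM, Metric.tendsto_nhds.1 (hl x) _ (by positivity : 0 < ε / 4)] with u h₁ h₂
    exact ⟨h₁, by rwa [dist_eq_norm] at h₂⟩
  filter_upwards [(eventually_bumpFilter μ hV).prod_mk hu]
  rintro ⟨z, u⟩ ⟨⟨hz₀, hzV, hz₁⟩, huM, hux⟩
  have hint : ∀ s, ρ.π (bumpTensor 𝕜 z u s) (ρ.U s x) = z s • ρ.π u (ρ.U s x) := fun s => by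
    rw [bumpTensor_apply, map_smul]; rfl
  have e : ρ.integratedForm μ (bumpTensor 𝕜 z u) x = ∫ s, z s • ρ.π u (ρ.U s x) ∂μ := by
    simp only [← hint]; rfl
  have hzi : Integrable z μ := z.continuous.integrable_of_hasCompactSupport z.hasCompactSupport
  have ex : x = ∫ s, z s • x ∂μ := by rw [integral_smul_const, hz₁, one_smul]
  rw [dist_eq_norm, e]
  nth_rewrite 2 [ex]
  rw [← integral_sub]
  · have hle : ∀ s, ‖z s • ρ.π u (ρ.U s x) - z s • x‖ ≤ z s * (ε / 2) := by
      intro s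
      by_cases hs : C * max M 0 * ‖ρ.U s x - x‖ < ε / 4
      · rw [← smul_sub, norm_smul, Real.norm_of_nonneg (hz₀ s)]
        refine mul_le_mul_of_nonneg_left ?_ (hz₀ s)
        have e₁ : ρ.π u (ρ.U s x) - x = ρ.π u (ρ.U s x - x) + (ρ.π u x - x) := by
          rw [map_sub]; abel
        have h₁ : ‖ρ.π u (ρ.U s x - x)‖ ≤ C * max M 0 * ‖ρ.U s x - x‖ :=
          (ρ.π u).le_of_opNorm_le ((hπ u).trans (by gcongr; exact huM.trans (le_max_left _ _))) _
        rw [e₁]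
        exact (norm_add_le _ _).trans (by linarith)
      · rw [hzV s hs]; simp
    calc ‖∫ s, (z s • ρ.π u (ρ.U s x) - z s • x) ∂μ‖ ≤ ∫ s, z s * (ε / 2) ∂μ :=
          norm_integral_le_of_norm_le (hzi.mul_const _) (Filter.Eventually.of_forall hle)
      _ = ε / 2 := by rw [integral_mul_const, hz₁, one_mul]
      _ < ε := by linarith
  · have := (ρ.continuous_integrand (bumpTensor 𝕜 z u) x).integrable_of_hasCompactSupport (μ := μ)
      (ρ.compactSupport_integrand (bumpTensor 𝕜 z u) x)
    simpa only [hint] using this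
  · exact hzi.smul_const x

end ContCovariantRep

end Crossed

/-! ### Estimates for the seminorm of the crossed product -/

section CrossedModule

variable {𝕜 A G : Type*} [RCLike 𝕜] [NonUnitalNormedRing A] [NormedSpace 𝕜 A]
  [IsScalarTower 𝕜 A A] [SMulCommClass 𝕜 A A] [CompleteSpace A] [Group G]
  [TopologicalSpace G] [IsTopologicalGroup G] [LocallyCompactSpace G] [T2Space G]
  [MeasurableSpace G] [BorelSpace G] {α : BanachDynamicalSystem 𝕜 A G}
  (μ : Measure G) [IsFiniteMeasureOnCompacts μ] (R : UniformlyBoundedClass.{w} α)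

theorem UniformlyBoundedClass.norm_integratedForm_le_crossedSeminorm {ρ : BundledCovariantRep α}
    (hρ : ρ ∈ R.carrier) (f : C_c(G, A)) :
    ‖ρ.rep.integratedForm μ f‖ ≤ crossedSeminorm μ R f :=
  le_ciSup (R.bddAbove μ f) ⟨ρ, hρ⟩

theorem crossedSeminorm_le {f : C_c(G, A)} {M : ℝ}
    (h : ∀ ρ ∈ R.carrier, ‖ρ.rep.integratedForm μ f‖ ≤ M) : crossedSeminorm μ R f ≤ M := by
  have : Nonempty R.carrier := R.nonempty.to_subtype
  exact ciSup_le fun ρ => h ρ.1 ρ.2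

/-- On functions supported in a fixed compact set `σ^R` is dominated by the `L¹`-norm. -/
theorem exists_crossedSeminorm_le_integral {K : Set G} (hK : IsCompact K) :
    ∃ D : ℝ, 0 ≤ D ∧ ∀ f : C_c(G, A), (∀ s, s ∉ K → f s = 0) →
      crossedSeminorm μ R f ≤ D * ∫ s, ‖f s‖ ∂μ := by
  obtain ⟨C, ν, hC, hν, hb, h⟩ := R.uniformly_bounded
  obtain ⟨M, hM⟩ := hb K hK
  refine ⟨C * max M 0, by positivity, fun f hf => crossedSeminorm_le μ R fun ρ hρ => ?_⟩
  refine ρ.rep.norm_integratedForm_le μ f hC (le_max_right _ _) (h ρ hρ).1 fun s hs => ?_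
  have hsK : s ∈ K := by
    refine closure_minimal (fun t ht => ?_) hK.isClosed hs
    by_contra h'
    exact ht (hf t h')
  exact ((h ρ hρ).2 s).trans ((hM ⟨s, hsK, rfl⟩).trans (le_max_left _ _))

/-- For `r` in a compact neighbourhood of `1` all supports lie in one compact set, so the `L¹`-norm
dominates; it depends continuously on `r` and vanishes at `r = 1`. -/
theorem tendsto_crossedSeminorm_translate (f : C_c(G, A)) :
    Filter.Tendsto (fun r => crossedSeminorm μ R (α.translate r f - f)) (𝓝 1) (𝓝 0) := by
  obtain ⟨N, hN, hN₁⟩ := exists_compact_mem_nhds (1 : G)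
  set K := N * tsupport f
  have hK : IsCompact K := hN.mul f.hasCompactSupport.isCompact
  have h0 : ∀ r t, r ∈ N → t ∉ K → (α.translate r f - f) t = 0 := by
    intro r t hr ht
    have h₁ := α.translate_eq_zero f hr ht
    -- The case `r = 1` shows that `f` itself vanishes outside `K`.
    have h₂ := α.translate_eq_zero f (mem_of_mem_nhds hN₁) ht
    rw [CompactlySupportedContinuousMap.sub_apply, BanachDynamicalSystem.translate_apply, h₁]
    simpa using h₂
  obtain ⟨D, hD, h⟩ := exists_crossedSeminorm_le_integral μ R hK
  have hcont : ContinuousOn (fun r => ∫ t, ‖(α.translate r f - f) t‖ ∂μ) N := by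
    refine continuousOn_integral_of_compact_support hK (Continuous.continuousOn ?_)
      fun r t hr ht => by rw [h0 r t hr ht, norm_zero]
    exact ((α.continuous_translate_uncurry f).sub (f.continuous.comp continuous_snd)).norm
  have hlim := (hcont.continuousAt hN₁).tendsto.const_mul D
  have h1 : α.translate 1 f - f = 0 := by
    ext t
    simp [BanachDynamicalSystem.translate_apply]
  simp only [h1] at hlim
  refine squeeze_zero' (Filter.Eventually.of_forall fun r => apply_nonneg _ _) ?_
    (by simpa using hlim)
  filter_upwards [hN₁] with r hr
  exact h _ fun t => h0 r t hr

/-- The image of the support of `f` is compact, and the approximate identity converges uniformly on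
it; domination by the `L¹`-norm does the rest. -/
theorem tendsto_crossedSeminorm_pointwiseMul {l : Filter A} {M : ℝ} (hM : ∀ᶠ u in l, ‖u‖ ≤ M)
    (hl : ∀ a, Filter.Tendsto (fun u => u * a) l (𝓝 a)) (f : C_c(G, A)) :
    Filter.Tendsto (fun u => crossedSeminorm μ R (pointwiseMul u f - f)) l (𝓝 0) := by
  have hK := f.hasCompactSupport.isCompact
  obtain ⟨D, hD, h⟩ := exists_crossedSeminorm_le_integral μ R hK
  set m := μ.real (tsupport f)
  have hm : 0 ≤ m := measureReal_nonneg
  rw [Metric.tendsto_nhds]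
  intro ε hε
  have hδ : 0 < ε / (D * m + 1) := by positivity
  filter_upwards [eventually_forall_norm_mul_sub_lt hM hl (hK.image f.continuous) hδ] with u hu
  have h0 : ∀ s, s ∉ tsupport f → (pointwiseMul u f - f) s = 0 := fun s hs => by
    rw [CompactlySupportedContinuousMap.sub_apply, pointwiseMul_apply,
      image_eq_zero_of_notMem_tsupport hs, mul_zero, sub_zero]
  rw [Real.dist_0_eq_abs, abs_of_nonneg (apply_nonneg _ _)]
  have h₁ : ∫ s, ‖(pointwiseMul u f - f) s‖ ∂μ ≤ ε / (D * m + 1) * m := by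
    rw [← setIntegral_eq_integral_of_forall_compl_eq_zero (s := tsupport f)
      fun s hs => by rw [h0 s hs, norm_zero]]
    refine (Real.le_norm_self _).trans (norm_setIntegral_le_of_norm_le_const hK.measure_lt_top
      fun s hs => ?_)
    rw [norm_norm]
    exact (hu (f s) ⟨s, hs, rfl⟩).le
  calc _ ≤ D * (ε / (D * m + 1) * m) := (h _ h0).trans (by gcongr)
    _ = ε * (D * m / (D * m + 1)) := by ring
    _ < ε * 1 := by
      gcongr
      rw [div_lt_one (by positivity)]
      exact lt_add_one _
    _ = ε := mul_one _

/-! ### The crossed product as seen through the representations in `R` -/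

variable [μ.IsMulLeftInvariant]

theorem UniformlyBoundedClass.isRContinuous {ρ : BundledCovariantRep α} (hρ : ρ ∈ R.carrier) :
    ρ.rep.IsRContinuous μ R :=
  ⟨1, fun f => by rw [one_mul]; exact R.norm_integratedForm_le_crossedSeminorm μ hρ f⟩

theorem norm_quotientMap (f : C_c(G, A)) : ‖quotientMap μ R f‖ = crossedSeminorm μ R f :=
  BanachCompletion.norm_of (E := TwistedConvAlgebra μ R) f

theorem quotientMap_sub (f g : C_c(G, A)) :
    quotientMap μ R (f - g) = quotientMap μ R f - quotientMap μ R g :=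
  map_sub (BanachCompletion.ofL 𝕜 (TwistedConvAlgebra μ R)) f g

theorem denseRange_quotientMap : DenseRange (quotientMap μ R) :=
  BanachCompletion.denseRange_of (E := TwistedConvAlgebra μ R)

theorem dense_span_quotientMap :
    Dense (Submodule.span 𝕜 (Set.range (quotientMap μ R)) : Set (CrossedProduct μ R)) :=
  (denseRange_quotientMap μ R).mono Submodule.subset_span

namespace ContCovariantRep

variable {μ R} {X : Type*} [NormedAddCommGroup X] [NormedSpace 𝕜 X] [CompleteSpace X]
  (ρ : ContCovariantRep α X) (h : ρ.IsRContinuous μ R)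

theorem induced_mul (b c : CrossedProduct μ R) :
    ρ.induced μ h (b * c) = ρ.induced μ h b * ρ.induced μ h c := by
  refine (denseRange_quotientMap μ R).induction_on₂
    (p := fun b c => ρ.induced μ h (b * c) = ρ.induced μ h b * ρ.induced μ h c)
    (isClosed_eq (by fun_prop) (by fun_prop)) (fun f g => ?_) b c
  have : quotientMap μ R f * quotientMap μ R g = quotientMap μ R (α.twistedConv μ f g) :=
    (BanachCompletion.of_mul (E := TwistedConvAlgebra μ R) f g).symm
  rw [this, induced_quotientMap, induced_quotientMap, induced_quotientMap, integratedForm_mul]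

/-- An operator that commutes with `π` and `U` commutes with the induced representation. -/
theorem commute_induced {S : X →L[𝕜] X} (hπ : ∀ a, Commute S (ρ.π a))
    (hU : ∀ s, Commute S (ρ.U s)) (b : CrossedProduct μ R) : Commute S (ρ.induced μ h b) := by
  refine (denseRange_quotientMap μ R).induction_on (p := fun b => S * ρ.induced μ h b =
    ρ.induced μ h b * S) b (isClosed_eq (by fun_prop) (by fun_prop)) fun f => ?_
  rw [induced_quotientMap]
  exact ρ.commute_integratedForm μ hπ hU f

end ContCovariantRep

variable {R} in
theorem UniformlyBoundedClass.norm_induced_le {ρ : BundledCovariantRep α} (hρ : ρ ∈ R.carrier) :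
    ‖ρ.rep.induced μ (R.isRContinuous μ hρ)‖ ≤ 1 :=
  BanachCompletion.norm_le_of zero_le_one fun f => by
    refine (congrArg norm (ρ.rep.induced_quotientMap μ (R.isRContinuous μ hρ) f)).le.trans ?_
    rw [one_mul]
    exact R.norm_integratedForm_le_crossedSeminorm μ hρ f

/-- The norm of the crossed product is determined by the representations in `R`. -/
theorem CrossedProduct.norm_le {b : CrossedProduct μ R} {M : ℝ}
    (h : ∀ ρ (hρ : ρ ∈ R.carrier), ‖ρ.rep.induced μ (R.isRContinuous μ hρ) b‖ ≤ M) : ‖b‖ ≤ M := by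
  refine le_of_forall_pos_le_add fun ε hε => ?_
  obtain ⟨f, hf⟩ := (denseRange_quotientMap μ R).exists_dist_lt b (half_pos hε)
  rw [dist_eq_norm] at hf
  have h₁ : ‖quotientMap μ R f‖ ≤ M + ε / 2 := by
    rw [norm_quotientMap]
    refine crossedSeminorm_le μ R fun ρ hρ => ?_
    rw [← ρ.rep.induced_quotientMap μ (R.isRContinuous μ hρ)]
    set T := ρ.rep.induced μ (R.isRContinuous μ hρ)
    have e : T (quotientMap μ R f) = T b - T (b - quotientMap μ R f) := by rw [map_sub]; abel
    have h₂ : ‖T (b - quotientMap μ R f)‖ ≤ ‖b - quotientMap μ R f‖ :=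
      T.le_of_opNorm_le (UniformlyBoundedClass.norm_induced_le μ hρ) _ |>.trans (one_mul _).le
    rw [e]
    exact (norm_sub_le _ _).trans (by linarith [h ρ hρ])
  have e : b = (b - quotientMap μ R f) + quotientMap μ R f := by abel
  calc ‖b‖ ≤ ‖b - quotientMap μ R f‖ + ‖quotientMap μ R f‖ := by
        conv_lhs => rw [e]
        exact norm_add_le _ _
    _ ≤ M + ε := by linarith

/-- Identities in the crossed product thereby reduce to identities between operators on the spaces
of `R`, where `leftMul` and `translation` become composition with `π(a)` and `U_r`. -/
theorem CrossedProduct.ext {b c : CrossedProduct μ R}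
    (h : ∀ ρ (hρ : ρ ∈ R.carrier), ρ.rep.induced μ (R.isRContinuous μ hρ) b =
      ρ.rep.induced μ (R.isRContinuous μ hρ) c) : b = c := by
  rw [← sub_eq_zero, ← norm_le_zero_iff]
  refine CrossedProduct.norm_le μ R fun ρ hρ => ?_
  rw [map_sub, h ρ hρ, sub_self, norm_zero]

/-! ### The actions of `A` and `G` on the crossed product -/

/-- A linear map on `C_c(G, A)` that is bounded for `σ^R` extends to the crossed product. -/
theorem exists_crossedProduct_operator (Φ : C_c(G, A) →ₗ[𝕜] C_c(G, A)) {M : ℝ} (hM : 0 ≤ M)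
    (h : ∀ f, crossedSeminorm μ R (Φ f) ≤ M * crossedSeminorm μ R f) :
    ∃ L : CrossedProduct μ R →L[𝕜] CrossedProduct μ R,
      (∀ f, L (quotientMap μ R f) = quotientMap μ R (Φ f)) ∧ ‖L‖ ≤ M := by
  let Φ' : TwistedConvAlgebra μ R →ₗ[𝕜] TwistedConvAlgebra μ R := Φ
  let Ψ : TwistedConvAlgebra μ R →L[𝕜] TwistedConvAlgebra μ R := Φ'.mkContinuous M h
  exact ⟨BanachCompletion.map Ψ, fun f => BanachCompletion.map_of Ψ f,
    (BanachCompletion.norm_map_le Ψ).trans (Φ'.mkContinuous_norm_le hM h)⟩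

/-- For `(π, U)` in `R`, multiplying `f` by `a` composes `π ⋊ U(f)` with `π(a)`, and `‖π(a)‖ ≤ C
‖a‖` with `C` common to the whole class. -/
theorem exists_leftMul : ∃ C : ℝ, 0 ≤ C ∧ ∀ a : A,
    ∃ L : CrossedProduct μ R →L[𝕜] CrossedProduct μ R,
      (∀ f, L (quotientMap μ R f) = quotientMap μ R (pointwiseMul a f)) ∧ ‖L‖ ≤ C * ‖a‖ := by
  obtain ⟨C, ν, hC, -, -, h⟩ := R.uniformly_bounded
  refine ⟨C, hC, fun a => ?_⟩
  let Φ : C_c(G, A) →ₗ[𝕜] C_c(G, A) :=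
    { toFun := pointwiseMul a
      map_add' := fun f g => by ext s; exact mul_add _ _ _
      map_smul' := fun c f => by ext s; exact mul_smul_comm _ _ _ }
  refine exists_crossedProduct_operator μ R Φ (by positivity) fun f =>
    crossedSeminorm_le μ R fun ρ hρ => ?_
  change ‖ρ.rep.integratedForm μ (pointwiseMul a f)‖ ≤ _
  rw [ContCovariantRep.integratedForm_pointwiseMul]
  exact (norm_mul_le _ _).trans (mul_le_mul ((h ρ hρ).1 a)
    (R.norm_integratedForm_le_crossedSeminorm μ hρ f) (norm_nonneg _) (by positivity))

/-- Translation composes `π ⋊ U(f)` with `U_r`. The bound `ν` is recorded because its boundedness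
near `1` is needed for strong continuity. -/
theorem exists_translation : ∃ ν : G → ℝ, (∀ K, IsCompact K → BddAbove (ν '' K)) ∧ ∀ r : G,
    ∃ L : CrossedProduct μ R →L[𝕜] CrossedProduct μ R,
      (∀ f, L (quotientMap μ R f) = quotientMap μ R (α.translate r f)) ∧ ‖L‖ ≤ ν r := by
  obtain ⟨C, ν, -, hν, hb, h⟩ := R.uniformly_bounded
  refine ⟨ν, hb, fun r => ?_⟩
  let Φ : C_c(G, A) →ₗ[𝕜] C_c(G, A) :=
    { toFun := α.translate r
      map_add' := fun f g => by ext s; exact map_add (α.act r) _ _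
      map_smul' := fun c f => by ext s; exact map_smul (α.act r) _ _ }
  refine exists_crossedProduct_operator μ R Φ (hν r) fun f =>
    crossedSeminorm_le μ R fun ρ hρ => ?_
  change ‖ρ.rep.integratedForm μ (α.translate r f)‖ ≤ _
  rw [ContCovariantRep.integratedForm_translate]
  exact (norm_mul_le _ _).trans (mul_le_mul ((h ρ hρ).2 r)
    (R.norm_integratedForm_le_crossedSeminorm μ hρ f) (norm_nonneg _) (hν r))

/-- The operator on the crossed product extending `f ↦ a f`. -/
noncomputable def leftMul (a : A) : CrossedProduct μ R →L[𝕜] CrossedProduct μ R :=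
  ((exists_leftMul μ R).choose_spec.2 a).choose

theorem leftMul_quotientMap (a : A) (f : C_c(G, A)) :
    leftMul μ R a (quotientMap μ R f) = quotientMap μ R (pointwiseMul a f) :=
  ((exists_leftMul μ R).choose_spec.2 a).choose_spec.1 f

theorem exists_norm_leftMul_le : ∃ C : ℝ, 0 ≤ C ∧ ∀ a, ‖leftMul μ R a‖ ≤ C * ‖a‖ :=
  ⟨_, (exists_leftMul μ R).choose_spec.1,
    fun a => ((exists_leftMul μ R).choose_spec.2 a).choose_spec.2⟩

/-- The operator on the crossed product extending the translation of functions. -/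
noncomputable def translation (r : G) : CrossedProduct μ R →L[𝕜] CrossedProduct μ R :=
  ((exists_translation μ R).choose_spec.2 r).choose

theorem translation_quotientMap (r : G) (f : C_c(G, A)) :
    translation μ R r (quotientMap μ R f) = quotientMap μ R (α.translate r f) :=
  ((exists_translation μ R).choose_spec.2 r).choose_spec.1 f

theorem exists_norm_translation_le : ∃ M : ℝ, ∀ᶠ r in 𝓝 1, ‖translation μ R r‖ ≤ M := by
  obtain ⟨N, hN, hN₁⟩ := exists_compact_mem_nhds (1 : G)
  obtain ⟨M, hM⟩ := (exists_translation μ R).choose_spec.1 N hN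
  refine ⟨M, ?_⟩
  filter_upwards [hN₁] with r hr
  exact ((exists_translation μ R).choose_spec.2 r).choose_spec.2.trans (hM ⟨r, hr, rfl⟩)

namespace ContCovariantRep

variable {μ R} {X : Type*} [NormedAddCommGroup X] [NormedSpace 𝕜 X] [CompleteSpace X]
  (ρ : ContCovariantRep α X) (h : ρ.IsRContinuous μ R)

theorem induced_leftMul (a : A) (b : CrossedProduct μ R) :
    ρ.induced μ h (leftMul μ R a b) = ρ.π a * ρ.induced μ h b := by
  refine (denseRange_quotientMap μ R).induction_on (p := fun b => ρ.induced μ h (leftMul μ R a b) =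
    ρ.π a * ρ.induced μ h b) b (isClosed_eq (by fun_prop) (by fun_prop)) fun f => ?_
  rw [leftMul_quotientMap, induced_quotientMap, induced_quotientMap, integratedForm_pointwiseMul]

theorem induced_translation (r : G) (b : CrossedProduct μ R) :
    ρ.induced μ h (translation μ R r b) = ρ.U r * ρ.induced μ h b := by
  refine (denseRange_quotientMap μ R).induction_on (p := fun b =>
    ρ.induced μ h (translation μ R r b) = ρ.U r * ρ.induced μ h b) b
    (isClosed_eq (by fun_prop) (by fun_prop)) fun f => ?_
  rw [translation_quotientMap, induced_quotientMap, induced_quotientMap, integratedForm_translate]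

end ContCovariantRep

theorem isLeftMultiplier_leftMul (a : A) : IsLeftMultiplier (leftMul μ R a) := fun b c =>
  CrossedProduct.ext μ R fun ρ hρ => by
    simp only [ContCovariantRep.induced_mul, ContCovariantRep.induced_leftMul, mul_assoc]

theorem isLeftMultiplier_translation (r : G) : IsLeftMultiplier (translation μ R r) := fun b c =>
  CrossedProduct.ext μ R fun ρ hρ => by
    simp only [ContCovariantRep.induced_mul, ContCovariantRep.induced_translation, mul_assoc]

/-- The canonical covariant representation of `(A, G, α)` on the crossed product. -/
noncomputable def canonicalRep : ContCovariantRep α (CrossedProduct μ R) where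
  π :=
    { toFun := leftMul μ R
      map_smul' := fun c a => by
        ext1 b
        refine CrossedProduct.ext μ R fun ρ hρ => ?_
        change ρ.rep.induced μ _ _ = ρ.rep.induced μ _ (c • leftMul μ R a b)
        rw [map_smul, ContCovariantRep.induced_leftMul, ContCovariantRep.induced_leftMul, map_smul,
          smul_mul_assoc]
      map_zero' := by
        ext1 b
        refine CrossedProduct.ext μ R fun ρ hρ => ?_
        rw [ContCovariantRep.induced_leftMul, map_zero, zero_mul]
        exact (map_zero _).symm
      map_add' := fun a a' => by
        ext1 b
        refine CrossedProduct.ext μ R fun ρ hρ => ?_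
        rw [add_apply, map_add]
        simp only [ContCovariantRep.induced_leftMul, map_add, add_mul]
      map_mul' := fun a a' => by
        ext1 b
        refine CrossedProduct.ext μ R fun ρ hρ => ?_
        rw [mul_apply_eq_comp]
        simp only [ContCovariantRep.induced_leftMul, map_mul, mul_assoc] }
  U :=
    { toFun := translation μ R
      map_one' := by
        ext1 b
        refine CrossedProduct.ext μ R fun ρ hρ => ?_
        rw [ContCovariantRep.induced_translation, map_one, one_mul]
        rfl
      map_mul' := fun r s => by
        ext1 b
        refine CrossedProduct.ext μ R fun ρ hρ => ?_
        rw [mul_apply_eq_comp]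
        simp only [ContCovariantRep.induced_translation, map_mul, mul_assoc] }
  covariant := fun s a => by
    ext1 b
    refine CrossedProduct.ext μ R fun ρ hρ => ?_
    change ρ.rep.induced μ _ (leftMul μ R _ b) = ρ.rep.induced μ _
      (translation μ R s (leftMul μ R a (translation μ R s⁻¹ b)))
    simp only [ContCovariantRep.induced_translation, ContCovariantRep.induced_leftMul,
      ρ.rep.covariant, mul_assoc]
  bounded := by
    obtain ⟨C, -, h⟩ := exists_norm_leftMul_le μ R
    exact ⟨C, h⟩
  continuous := by
    obtain ⟨M, hM⟩ := exists_norm_translation_le μ R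
    refine continuous_of_tendsto_one hM (dense_span_quotientMap μ R) ?_
    rintro _ ⟨f, rfl⟩
    rw [tendsto_iff_norm_sub_tendsto_zero]
    refine (tendsto_crossedSeminorm_translate μ R f).congr fun r => ?_
    change _ = ‖translation μ R r (quotientMap μ R f) - quotientMap μ R f‖
    rw [translation_quotientMap, ← quotientMap_sub, norm_quotientMap]

theorem canonicalRep_π (a : A) : (canonicalRep μ R).π a = leftMul μ R a := rfl

theorem canonicalRep_U (r : G) : (canonicalRep μ R).U r = translation μ R r := rfl

/-- The integrated form of the canonical covariant representation is left multiplication. -/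
theorem canonicalRep_integratedForm (f : C_c(G, A)) (b : CrossedProduct μ R) :
    (canonicalRep μ R).integratedForm μ f b = quotientMap μ R f * b := by
  refine CrossedProduct.ext μ R fun ρ hρ => ?_
  ext x
  set T := ρ.rep.induced μ (R.isRContinuous μ hρ) with hT
  rw [ContCovariantRep.induced_mul, ContCovariantRep.induced_quotientMap, mul_apply_eq_comp,
    ContCovariantRep.integratedForm_apply, ContCovariantRep.integratedForm_apply]
  -- The bounded linear map `b ↦ T b x` is moved inside the integral, where it turns the canonical
  -- actions into `π(f(s)) U_s`.
  refine (vecIntegral_clm ((ContinuousLinearMap.apply 𝕜 ρ.X x).comp T)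
    ((canonicalRep μ R).continuous_integrand f b)
    ((canonicalRep μ R).compactSupport_integrand f b)).symm.trans ?_
  congr 1
  funext s
  change T (leftMul μ R (f s) (translation μ R s b)) x = _
  rw [hT, ContCovariantRep.induced_leftMul, ContCovariantRep.induced_translation]
  rfl

theorem tendsto_leftMul {l : Filter A} {M : ℝ} (hM : ∀ᶠ u in l, ‖u‖ ≤ M)
    (hl : ∀ a, Filter.Tendsto (fun u => u * a) l (𝓝 a)) (b : CrossedProduct μ R) :
    Filter.Tendsto (fun u => leftMul μ R u b) l (𝓝 b) := by
  obtain ⟨C, hC, h⟩ := exists_norm_leftMul_le μ R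
  refine tendsto_of_dense_span (M := C * M) ?_ (dense_span_quotientMap μ R) ?_ b
  · filter_upwards [hM] with u hu
    exact (h u).trans (by gcongr)
  · rintro _ ⟨f, rfl⟩
    rw [tendsto_iff_norm_sub_tendsto_zero]
    refine (tendsto_crossedSeminorm_pointwiseMul μ R hM hl f).congr fun r => ?_
    rw [leftMul_quotientMap, ← quotientMap_sub, norm_quotientMap]

/-- The crossed product has a bounded approximate left identity if `A` has one. -/
theorem CrossedProduct.hasBoundedApproxLeftId [μ.IsOpenPosMeasure]
    (hA : HasBoundedApproxLeftId A) : HasBoundedApproxLeftId (CrossedProduct μ R) := by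
  obtain ⟨l, hl, ⟨M, hM⟩, hu⟩ := hA
  refine ⟨(bumpFilter μ ×ˢ l).map fun p => quotientMap μ R (bumpTensor 𝕜 p.1 p.2), inferInstance,
    ?_, fun b => ?_⟩
  · obtain ⟨N, hN, hN₁⟩ := exists_compact_mem_nhds (1 : G)
    obtain ⟨D, hD, h⟩ := exists_crossedSeminorm_le_integral μ R hN
    -- `D` handles functions supported in `N`, and the `L¹`-norm of `z ⊗ u` is `‖u‖`, since `z ≥ 0`
    -- has integral one.
    refine ⟨D * M, Filter.eventually_map.2 ?_⟩
    filter_upwards [(eventually_bumpFilter μ hN₁).prod_mk hM]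
    rintro ⟨z, u⟩ ⟨⟨hz₀, hzN, hz₁⟩, huM⟩
    rw [norm_quotientMap]
    refine (h _ fun s hs => ?_).trans (mul_le_mul_of_nonneg_left ?_ hD)
    · rw [bumpTensor_apply, hzN s hs]; simp
    · have : ∀ s, ‖bumpTensor 𝕜 z u s‖ = z s * ‖u‖ := fun s => by
        rw [bumpTensor_apply, norm_smul, RCLike.norm_ofReal, abs_of_nonneg (hz₀ s)]
      simp only [this]
      rw [integral_mul_const, hz₁, one_mul]
      exact huM
  · rw [Filter.tendsto_map'_iff]
    have := (canonicalRep μ R).tendsto_integratedForm_bumpTensor μ hM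
      (tendsto_leftMul μ R hM hu) b
    simpa only [canonicalRep_integratedForm, Function.comp_def] using this

/-! ### Covariant representations and representations of the crossed product -/

variable {μ R} {X : Type*} [NormedAddCommGroup X] [NormedSpace 𝕜 X] [CompleteSpace X]

/-- Non-degeneracy of `π` gives `π(u) x → x`, hence `π ⋊ U (z ⊗ u) x → x`, so every `x` is a limit
of vectors in the range. -/
theorem ContCovariantRep.isNondegenerateBoundedRep_induced [μ.IsOpenPosMeasure]
    (hA : HasBoundedApproxLeftId A) (ρ : ContCovariantRep α X) (h : ρ.IsRContinuous μ R)
    (hρ : ρ.IsNondegenerate) : IsNondegenerateBoundedRep (ρ.induced μ h) := by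
  refine ⟨ρ.induced_mul h, fun x => ?_⟩
  obtain ⟨l, hl, ⟨M, hM⟩, hu⟩ := hA
  refine mem_closure_of_tendsto
    (ρ.tendsto_integratedForm_bumpTensor μ hM (ρ.tendsto_π hρ hM hu) x)
    (Filter.Eventually.of_forall fun p => Submodule.subset_span
      ⟨quotientMap μ R (bumpTensor 𝕜 p.1 p.2), x, by rw [induced_quotientMap]⟩)

/-- A non-degenerate `R`-continuous covariant representation is determined by the induced
representation of the crossed product. -/
theorem ContCovariantRep.eq_of_induced_eq {ρ ρ' : ContCovariantRep α X}
    {h : ρ.IsRContinuous μ R} {h' : ρ'.IsRContinuous μ R}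
    (hT : IsNondegenerateBoundedRep (ρ.induced μ h)) (e : ρ.induced μ h = ρ'.induced μ h') :
    ρ = ρ' := by
  have hπ : ρ.π = ρ'.π := by
    ext1 a
    refine hT.ext fun b => ?_
    rw [← induced_leftMul, e, induced_leftMul]
  have hU : ρ.U = ρ'.U := by
    ext1 r
    refine hT.ext fun b => ?_
    rw [← induced_translation, e, induced_translation]
  obtain ⟨⟨π, U, _⟩, _, _⟩ := ρ
  obtain ⟨⟨π', U', _⟩, _, _⟩ := ρ'
  obtain rfl : π = π' := hπ
  obtain rfl : U = U' := hU
  rfl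

/-- Every non-degenerate bounded representation of the crossed product is induced by a
non-degenerate `R`-continuous covariant representation. -/
theorem IsNondegenerateBoundedRep.exists_eq_induced [μ.IsOpenPosMeasure]
    (hA : HasBoundedApproxLeftId A) {T : CrossedProduct μ R →L[𝕜] (X →L[𝕜] X)}
    (hT : IsNondegenerateBoundedRep T) :
    ∃ (ρ : ContCovariantRep α X) (h : ρ.IsRContinuous μ R), ρ.IsNondegenerate ∧
      ρ.induced μ h = T := by
  have hB := CrossedProduct.hasBoundedApproxLeftId μ R hA
  obtain ⟨π, hπ, hπmul⟩ := hT.exists_extension_rep hB (canonicalRep μ R).πL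
    (isLeftMultiplier_leftMul μ R) (fun a a' => _root_.map_mul (canonicalRep μ R).π a a')
  obtain ⟨K, hK, hext⟩ := hT.exists_extension hB
  -- The constant `K` serves all `r`, so `U` inherits from `translation` its boundedness near `1`.
  choose U hU hUn using fun r => hext (translation μ R r) (isLeftMultiplier_translation μ R r)
  replace hπ : ∀ a b, π a * T b = T (leftMul μ R a b) := hπ
  let V : G →* (X →L[𝕜] X) :=
    { toFun := U
      map_one' := hT.ext fun b => by
        rw [hU, one_mul, ← canonicalRep_U, map_one]; rfl
      map_mul' := fun r s => hT.ext fun b => by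
        rw [hU, mul_assoc, hU, hU, ← canonicalRep_U, _root_.map_mul]; rfl }
  have hV : ∀ r b, V r * T b = T (translation μ R r b) := hU
  let ρ : ContCovariantRep α X :=
    { π :=
        { toFun := π
          map_smul' := map_smul π
          map_zero' := map_zero π
          map_add' := map_add π
          map_mul' := hπmul }
      U := V
      covariant := fun s a => hT.ext fun b => by
        change π (α.act s a) * T b = V s * π a * V s⁻¹ * T b
        rw [mul_assoc, mul_assoc, hV, hπ, hπ, hV, ← canonicalRep_π,
          (canonicalRep μ R).covariant]
        rfl
      bounded := ⟨‖π‖, π.le_opNorm⟩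
      continuous := by
        obtain ⟨M, hM⟩ := exists_norm_translation_le μ R
        refine continuous_of_tendsto_one (M := K * M) ?_ hT.dense ?_
        · filter_upwards [hM] with r hr
          exact (hUn r).trans (by gcongr)
        · rintro _ ⟨b, x, rfl⟩
          have : ∀ r, V r (T b x) = T (translation μ R r b) x := fun r =>
            DFunLike.congr_fun (hV r b) x
          simp only [this]
          have hc : Continuous fun r => T (translation μ R r b) x :=
            (T.continuous.comp ((canonicalRep μ R).continuous b)).clm_apply continuous_const
          have := hc.tendsto 1
          rwa [← canonicalRep_U, map_one] at this }
  -- After multiplication by `T b`, the integrand is `T` of that of the canonical representation at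
  -- `b`, whose integral is `q(f) b`.
  have hint : ∀ f, ρ.integratedForm μ f = T (quotientMap μ R f) := by
    intro f
    refine hT.ext fun b => ?_
    rw [← hT.map_mul, ← canonicalRep_integratedForm]
    ext x
    rw [mul_apply_eq_comp, ContCovariantRep.integratedForm_apply,
      ContCovariantRep.integratedForm_apply]
    refine Eq.trans ?_ (vecIntegral_clm ((ContinuousLinearMap.apply 𝕜 X x).comp T)
      ((canonicalRep μ R).continuous_integrand f b)
      ((canonicalRep μ R).compactSupport_integrand f b))
    congr 1
    funext s
    change (π (f s) * (V s * T b)) x = T (leftMul μ R (f s) (translation μ R s b)) x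
    rw [hV, hπ]
  have hρ : ρ.IsRContinuous μ R := ⟨‖T‖, fun f => by
    rw [hint, ← norm_quotientMap]
    exact T.le_opNorm _⟩
  refine ⟨ρ, hρ, ?_, ?_⟩
  · obtain ⟨l, hl, ⟨M, hM⟩, hu⟩ := hA
    exact hT.dense_of_tendsto hπ (tendsto_leftMul μ R hM hu)
  · exact BanachCompletion.ext_of fun f => (ρ.induced_quotientMap μ hρ f).trans (hint f)

/-! ### Commutation of pairs and of induced representations -/

variable {A' G' : Type*} [NonUnitalNormedRing A'] [NormedSpace 𝕜 A']
  [IsScalarTower 𝕜 A' A'] [SMulCommClass 𝕜 A' A'] [CompleteSpace A'] [Group G']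
  [TopologicalSpace G'] [IsTopologicalGroup G'] [LocallyCompactSpace G'] [T2Space G']
  [MeasurableSpace G'] [BorelSpace G'] {α' : BanachDynamicalSystem 𝕜 A' G'}
  {μ' : Measure G'} [IsFiniteMeasureOnCompacts μ'] [μ'.IsMulLeftInvariant]
  {R' : UniformlyBoundedClass.{w} α'}

/-- Integration is applied twice: first `π(a)` and `U_s` are shown to commute with the
representation induced by `ρ'`, then the latter with the one induced by `ρ`. -/
theorem CovariantRep.CommutesWith.commute_induced {ρ : ContCovariantRep α X}
    {ρ' : ContCovariantRep α' X} (hc : ρ.CommutesWith ρ'.toCovariantRep)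
    (h : ρ.IsRContinuous μ R) (h' : ρ'.IsRContinuous μ' R') (b : CrossedProduct μ R)
    (b' : CrossedProduct μ' R') : Commute (ρ.induced μ h b) (ρ'.induced μ' h' b') := by
  obtain ⟨h₁, h₂, h₃, h₄⟩ := hc
  refine (ρ.commute_induced h (fun a => ?_) (fun s => ?_) b).symm
  · exact (ρ'.commute_induced h' (h₁ a) (h₂ a) b').symm
  · exact (ρ'.commute_induced h' (h₃ s) (h₄ s) b').symm

/-- The pairs are extensions of their induced representations to left multipliers, so commutation is
extended first on the side of `ρ` and then on that of `ρ'`. -/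
theorem ContCovariantRep.commutesWith_of_commute_induced {ρ : ContCovariantRep α X}
    {ρ' : ContCovariantRep α' X} {h : ρ.IsRContinuous μ R} {h' : ρ'.IsRContinuous μ' R'}
    (hT : IsNondegenerateBoundedRep (ρ.induced μ h))
    (hT' : IsNondegenerateBoundedRep (ρ'.induced μ' h'))
    (hc : ∀ b b', Commute (ρ.induced μ h b) (ρ'.induced μ' h' b')) :
    ρ.CommutesWith ρ'.toCovariantRep := by
  have hπ : ∀ a b', Commute (ρ.π a) (ρ'.induced μ' h' b') := fun a b' =>
    (hT.commute_extension (fun b => (ρ.induced_leftMul h a b).symm) fun b => (hc b b').symm).symm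
  have hU : ∀ s b', Commute (ρ.U s) (ρ'.induced μ' h' b') := fun s b' =>
    (hT.commute_extension (fun b => (ρ.induced_translation h s b).symm) fun b =>
      (hc b b').symm).symm
  exact ⟨fun a a' => hT'.commute_extension (fun b => (ρ'.induced_leftMul h' a' b).symm) (hπ a),
    fun a s' => hT'.commute_extension (fun b => (ρ'.induced_translation h' s' b).symm) (hπ a),
    fun s a' => hT'.commute_extension (fun b => (ρ'.induced_leftMul h' a' b).symm) (hU s),
    fun s s' => hT'.commute_extension (fun b => (ρ'.induced_translation h' s' b).symm) (hU s)⟩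

end CrossedModule

/-! ### The bijection for `n` systems -/

theorem mainTheorem7 {𝕜 : Type*} [RCLike 𝕜] {n : ℕ}
    {A : Fin n → Type*} {G : Fin n → Type*}
    [∀ i, NonUnitalNormedRing (A i)] [∀ i, NormedSpace 𝕜 (A i)]
    [∀ i, IsScalarTower 𝕜 (A i) (A i)] [∀ i, SMulCommClass 𝕜 (A i) (A i)]
    [∀ i, CompleteSpace (A i)]
    [∀ i, Group (G i)] [∀ i, TopologicalSpace (G i)] [∀ i, IsTopologicalGroup (G i)]
    [∀ i, LocallyCompactSpace (G i)] [∀ i, T2Space (G i)]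
    [∀ i, MeasurableSpace (G i)] [∀ i, BorelSpace (G i)]
    (α : ∀ i, BanachDynamicalSystem 𝕜 (A i) (G i))
    (hA : ∀ i, HasBoundedApproxLeftId (A i))
    (μ : ∀ i, Measure (G i)) [∀ i, (μ i).IsHaarMeasure]
    (R : ∀ i, UniformlyBoundedClass.{w} (α i))
    (hR : ∀ i, ∀ ρ ∈ (R i).carrier, ρ.rep.IsNondegenerate)
    {X : Type*} [NormedAddCommGroup X] [NormedSpace 𝕜 X] [CompleteSpace X] :
    Set.BijOn
      (fun ρ : ∀ i, {ρ : ContCovariantRep (α i) X // ρ.IsRContinuous (μ i) (R i)} =>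
        (sunProduct fun i => (ρ i).1.induced (μ i) (ρ i).2 :
          ProjTensorProduct 𝕜 (fun i => CrossedProduct (μ i) (R i)) →L[𝕜] (X →L[𝕜] X)))
      {ρ | (∀ i, (ρ i).1.IsNondegenerate) ∧
        ∀ i j, i ≠ j → (ρ i).1.CommutesWith (ρ j).1.toCovariantRep}
      {T | IsNondegenerateBoundedRep T} := by
  have hB : ∀ i, HasBoundedApproxLeftId (CrossedProduct (μ i) (R i)) := fun i =>
    CrossedProduct.hasBoundedApproxLeftId (μ i) (R i) (hA i)
  refine ⟨?_, ?_, ?_⟩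
  · rintro ρ ⟨hρ, hc⟩
    exact isNondegenerateBoundedRep_sunProduct
      (fun i => (ρ i).1.isNondegenerateBoundedRep_induced (hA i) (ρ i).2 (hρ i))
      fun i j h => (hc i j h).commute_induced (ρ i).2 (ρ j).2
  · rintro ρ ⟨hρ, hc⟩ ρ' ⟨hρ', hc'⟩ e
    have hT := fun i => (ρ i).1.isNondegenerateBoundedRep_induced (hA i) (ρ i).2 (hρ i)
    -- The product determines each induced representation, which in turn determines its covariant
    -- pair.
    have e' := sunProduct_injective hT
      (fun i => (ρ' i).1.isNondegenerateBoundedRep_induced (hA i) (ρ' i).2 (hρ' i))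
      (fun i j h => (hc i j h).commute_induced (ρ i).2 (ρ j).2)
      (fun i j h => (hc' i j h).commute_induced (ρ' i).2 (ρ' j).2) e
    funext i
    exact Subtype.ext (ContCovariantRep.eq_of_induced_eq (hT i) (congrFun e' i))
  · intro T hT
    -- `T` is first split into commuting representations of the crossed products, each of which is
    -- then disintegrated.
    obtain ⟨S, hS, hSc, rfl⟩ := IsNondegenerateBoundedRep.exists_eq_sunProduct hB hT
    choose ρ h hρ hρS using fun i => (hS i).exists_eq_induced (hA i)
    refine ⟨fun i => ⟨ρ i, h i⟩, ⟨hρ, fun i j hij => ?_⟩, ?_⟩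
    · refine ContCovariantRep.commutesWith_of_commute_induced (h := h i) (h' := h j) ?_ ?_ ?_
      · rw [hρS]; exact hS i
      · rw [hρS]; exact hS j
      · rw [hρS, hρS]; exact hSc i j hij
    · exact congrArg sunProduct (funext hρS)
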